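/- Let $G$ be a CPDAG on a finite vertex set, that is, the union of all DAGs in some Markov equivalence class, and let $[G]$ be the set of DAGs in that class (two DAGs are Markov equivalent if they encode the same conditional independences). Let $m$ be the number of edges of $G$, an undirected edge counting once. An arc $x\to y$ of a DAG is covered if $\mathrm{Pa}(x)\cup\{x\}=\mathrm{Pa}(y)$. The algorithm shd3-enum picks any $D_0\in[G]$, sets the global variable $\mathrm{vis}:=\{D_0\}$ and calls $\mathrm{enumerate}(D_0,0)$, where $\mathrm{enumerate}(D,i)$ does the following: if $i$ is even, output $D$; then, for each DAG $D'$ obtained from $D$ by reversing one covered arc, if $D'\notin\mathrm{vis}$, add $D'$ to $\mathrm{vis}$ and call $\mathrm{enumerate}(D',i+1)$; finally, if $i$ is odd, output $D$. Implement it in the unit-cost model with a DAG stored as the list of its arcs, sorted by their unordered pairs of end vertices (the loop runs through the arcs in this order), and with $\mathrm{vis}$ stored as a binary trie keyed by the arc orientations. Then there is an absolute constant $C$ such that for every CPDAG $G$ and every choice of $D_0\in[G]$ the algorithm terminates, outputs every DAG in $[G]$ exactly once and nothing else, any two consecutive output DAGs have structural Hamming distance (the number of unordered pairs of vertices with differing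 edge relations) at most $3$, and it has delay $O(m^2)$: the running time between two consecutive outputs is at most $C m^2$. Moreover, once $D_0$ is given in its stored form, the running time before the first output and the running time from the last output to termination are at most $C(m^2+1)$. -/

import Mathlib

namespace Shd3

/-! ### Graphs, Markov equivalence, CPDAGs

A graph is a set of ordered pairs of vertices; an edge is undirected if it is present in both
directions and directed otherwise. -/

/-- A DAG: no directed cycle (in particular no loop and no undirected edge). -/
def IsDAG {n : ℕ} (D : Digraph (Fin n)) : Prop :=
  ∀ v, ¬ Relation.TransGen D.Adj v v

/-- The vertices of `W` together with all their ancestors. -/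
def anc {n : ℕ} (D : Digraph (Fin n)) (W : Set (Fin n)) : Set (Fin n) :=
  {u | ∃ w ∈ W, Relation.ReflTransGen D.Adj u w}

/-- The moral graph of the subgraph of `D` induced by the ancestral set of `W`: adjacent vertices
and vertices with a common child (in the ancestral set) are joined. -/
def ancMoral {n : ℕ} (D : Digraph (Fin n)) (W : Set (Fin n)) : SimpleGraph (Fin n) where
  Adj u v := u ≠ v ∧ u ∈ anc D W ∧ v ∈ anc D W ∧
    (D.Adj u v ∨ D.Adj v u ∨ ∃ c ∈ anc D W, D.Adj u c ∧ D.Adj v c)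
  symm := ⟨fun u v h => ⟨h.1.symm, h.2.2.1, h.2.1, by
    rcases h.2.2.2 with h | h | ⟨c, hc, h₁, h₂⟩
    · exact Or.inr (Or.inl h)
    · exact Or.inl h
    · exact Or.inr (Or.inr ⟨c, hc, h₂, h₁⟩)⟩⟩
  loopless := ⟨fun _ h => h.1 rfl⟩

/-- The conditional independence `A ⊥ B | S` is encoded by the DAG `D` (directed global Markov
property, that is, d-separation in its moralization form): `S` separates `A` from `B` in the moral
graph of the ancestral set of `A ∪ B ∪ S`. -/
def Encodes {n : ℕ} (D : Digraph (Fin n)) (A B S : Set (Fin n)) : Prop :=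
  ∀ a ∈ A, ∀ b ∈ B, ∀ p : (ancMoral D (A ∪ B ∪ S)).Walk a b, ∃ s ∈ S, s ∈ p.support

/-- Two DAGs are Markov equivalent if they encode the same conditional independences between
pairwise disjoint sets of variables. -/
def MarkovEquiv {n : ℕ} (D D' : Digraph (Fin n)) : Prop :=
  ∀ A B S : Set (Fin n), Disjoint A B → Disjoint A S → Disjoint B S →
    (Encodes D A B S ↔ Encodes D' A B S)

/-- The Markov equivalence class of `D`. -/
def mec {n : ℕ} (D : Digraph (Fin n)) : Set (Digraph (Fin n)) :=
  {D' | IsDAG D' ∧ MarkovEquiv D D'}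

/-- The CPDAG of `D`: the union of all the DAGs in its Markov equivalence class. -/
def cpdag {n : ℕ} (D : Digraph (Fin n)) : Digraph (Fin n) := sSup (mec D)

/-- `G` is a CPDAG. -/
def IsCPDAG {n : ℕ} (G : Digraph (Fin n)) : Prop :=
  ∃ D, IsDAG D ∧ cpdag D = G

/-- `[G]`: the DAGs in the Markov equivalence class represented by `G`. -/
def dags {n : ℕ} (G : Digraph (Fin n)) : Set (Digraph (Fin n)) :=
  {D | IsDAG D ∧ cpdag D = G}

/-- The number `m` of edges of `G` (an undirected edge counts once). -/
noncomputable def numEdges {n : ℕ} (G : Digraph (Fin n)) : ℕ :=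
  {p : Fin n × Fin n | p.1 ≤ p.2 ∧ (G.Adj p.1 p.2 ∨ G.Adj p.2 p.1)}.ncard

/-- Structural Hamming distance: the number of (unordered) pairs of vertices with differing edge
relations. -/
noncomputable def shd {n : ℕ} (G₁ G₂ : Digraph (Fin n)) : ℕ :=
  {p : Fin n × Fin n | p.1 ≤ p.2 ∧
    ¬ ((G₁.Adj p.1 p.2 ↔ G₂.Adj p.1 p.2) ∧ (G₁.Adj p.2 p.1 ↔ G₂.Adj p.2 p.1))}.ncard

/-! ### The algorithm

A DAG is stored as the list of its arcs `(a, b)` (meaning `a → b`), sorted lexicographically by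
`(min a b, max a b)`. Reversing an arc does not change its position, so every DAG that occurs in a
run is an orientation of one and the same list of edges. -/

/-- A stored DAG. -/
abbrev Arcs (n : ℕ) := List (Fin n × Fin n)

/-- The graph that is stored as `L`. -/
def ofArcs {n : ℕ} (L : Arcs n) : Digraph (Fin n) where
  Adj a b := (a, b) ∈ L

/-- The arcs are strictly sorted by their smaller, then by their larger end vertex. -/
def Sorted {n : ℕ} (L : Arcs n) : Prop :=
  L.Pairwise fun e f => min e.1 e.2 < min f.1 f.2 ∨
    (min e.1 e.2 = min f.1 f.2 ∧ max e.1 e.2 < max f.1 f.2)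

/-- Binary tries. A trie holds the keys whose path from the root does not run into `empty`; the
key of a stored DAG is its sequence of orientations (one bit per arc). -/
inductive Trie where
  | empty : Trie
  | node : Trie → Trie → Trie

/-- The state of a run: the global variable `vis`, the number of elementary steps made so far, and
the outputs so far, oldest first, each with the time at which it was completed. -/
structure State (n : ℕ) where
  vis : Trie
  clock : ℕ
  log : List (Arcs n × ℕ)

/-- The state at the start. -/
def State.init (n : ℕ) : State n := ⟨Trie.empty, 0, []⟩

/-- Programs: they act on the state and may fail to terminate (`none`). -/
abbrev Prog (n : ℕ) := StateT (State n) Option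

/-- One elementary step.

Cost convention: each of the procedures below that is recursive, or calls another one, makes one
step per call (including each recursive call). Apart from calls to charged procedures its body does
a bounded number of unit operations: taking a list cell or trie node apart or building one,
comparing two vertices, arithmetic on the recursion depth, reading or writing the pointer `vis`.
The fields `clock` and `log` only record the run; no procedure reads them to compute. -/
def tick {n : ℕ} : Prog n Unit :=
  modify fun s => { s with clock := s.clock + 1 }

/-- The parents of `v`, in increasing order. -/
def parents {n : ℕ} : Arcs n → Fin n → Prog n (List (Fin n))
  | [], _ => do
    tick
    return []
  | (a, b) :: D, v => do
    tick
    let ps ← parents D v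
    if b = v then return a :: ps else return ps

/-- Insert `x` into an increasing list. -/
def insertSorted {n : ℕ} (x : Fin n) : List (Fin n) → Prog n (List (Fin n))
  | [] => do
    tick
    return [x]
  | a :: l => do
    tick
    if x < a then
      return x :: a :: l
    else if x = a then
      return a :: l
    else
      let l' ← insertSorted x l
      return a :: l'

/-- Compare two lists. -/
def eqLists {n : ℕ} : List (Fin n) → List (Fin n) → Prog n Bool
  | [], [] => do
    tick
    return true
  | a :: l, b :: k => do
    tick
    if a = b then eqLists l k else return false
  | _, _ => do
    tick
    return false

/-- Is the arc `x → y` covered, that is, `Pa(x) ∪ {x} = Pa(y)`? -/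
def isCovered {n : ℕ} (D : Arcs n) (x y : Fin n) : Prog n Bool := do
  tick
  let px ← parents D x
  let px' ← insertSorted x px
  let py ← parents D y
  eqLists px' py

/-- A copy of `D` with the arc `x → y` reversed. -/
def reverseArc {n : ℕ} (x y : Fin n) : Arcs n → Prog n (Arcs n)
  | [] => do
    tick
    return []
  | (a, b) :: D => do
    tick
    let D' ← reverseArc x y D
    if a = x ∧ b = y then return (b, a) :: D' else return (a, b) :: D'

/-- Look up a stored DAG in a trie. -/
def lookup {n : ℕ} : Trie → Arcs n → Prog n Bool
  | .empty, _ => do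
    tick
    return false
  | .node _ _, [] => do
    tick
    return true
  | .node l r, (a, b) :: D => do
    tick
    if a < b then lookup l D else lookup r D

/-- Insert a stored DAG into a trie. -/
def insertKey {n : ℕ} : Arcs n → Trie → Prog n Trie
  | [], .empty => do
    tick
    return .node .empty .empty
  | [], .node l r => do
    tick
    return .node l r
  | (a, b) :: D, .empty => do
    tick
    let t ← insertKey D .empty
    if a < b then return .node t .empty else return .node .empty t
  | (a, b) :: D, .node l r => do
    tick
    if a < b then
      let t ← insertKey D l
      return .node t r
    else
      let t ← insertKey D r
      return .node l t

/-- The test `D ∈ vis`. -/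
def isVisited {n : ℕ} (D : Arcs n) : Prog n Bool := do
  tick
  let s ← get
  lookup s.vis D

/-- `vis := vis ∪ {D}`. -/
def markVisited {n : ℕ} (D : Arcs n) : Prog n Unit := do
  tick
  let s ← get
  let t ← insertKey D s.vis
  modify fun s => { s with vis := t }

/-- Write down a list of arcs: one step for each arc. -/
def writeArcs {n : ℕ} : Arcs n → Prog n Unit
  | [] => tick
  | _ :: D => do
    tick
    writeArcs D

/-- Output `D`. -/
def output {n : ℕ} (D : Arcs n) : Prog n Unit := do
  tick
  writeArcs D
  modify fun s => { s with log := s.log ++ [(D, s.clock)] }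

mutual

/-- The recursive procedure `enumerate(D, vis, i)`, with `vis` a global variable. -/
def enumerate {n : ℕ} (D : Arcs n) (i : ℕ) : Prog n Unit := do
  tick
  if i % 2 = 0 then output D
  forEach D D i
  if i % 2 = 1 then output D
  partial_fixpoint

/-- The loop of `enumerate(D, vis, i)` over the DAGs `D'` obtained by reversing a covered edge of
`D`; `todo` is the list of arcs of `D` that are still to be tried. -/
def forEach {n : ℕ} (D todo : Arcs n) (i : ℕ) : Prog n Unit := do
  tick
  match todo with
  | [] => return ()
  | (x, y) :: todo' =>
    if ← isCovered D x y then
      let D' ← reverseArc x y D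
      if ← isVisited D' then
        pure ()
      else
        markVisited D'
        enumerate D' (i + 1)
    forEach D todo' i
  partial_fixpoint

end

/-- The algorithm shd3-enum, run with the stored DAG `D` as its starting member of `[G]`. -/
def shd3Enum {n : ℕ} (D : Arcs n) : Prog n Unit := do
  tick
  markVisited D
  enumerate D 0

end Shd3

namespace Shd3

/-! ### Covered arcs and Markov equivalence -/

-- The class is connected under reversals of covered arcs, and a depth-first search that outputs on
-- entry at even depth and on exit at odd depth is never silent for long.
--
-- Connectivity is Chickering's theorem. Reversing a covered arc `x → y` preserves separations
-- (`Covered.encodes_of_reversal`): moral edges survive unless `x` leaves the ancestral set, and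
-- then the former neighbours of `x` form a clique, so walks can bypass `x`. Conversely, equivalent
-- DAGs share skeleton and v-structures, because non-adjacent vertices are separated by the parents
-- of one of them. Two distinct such DAGs disagree on an arc that is covered in the first
-- (`exists_covered`); reversing it lowers the number of disagreements. So a set that contains the
-- start and is closed under covered reversals is the whole class, and `vis` excludes repetitions.
--
-- For the distance, let the search pass from one child of `D` to the next. The last output of a
-- call is its argument at odd depth and at most one reversal away from it at even depth; for the
-- first output the parities are exchanged. Siblings have equal depth, so only one of the two ends
-- needs the extra reversal: with the steps to and from `D` this makes 3. The same parity count
-- bounds the time: only boundedly many loops' worth of work, each of `m` iterations with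
-- linear-time list and trie operations, can lie between two outputs. `EnumSpec` and `LoopSpec`
-- record these bounds, and `forEach_spec` proves them by induction on the number of unvisited
-- members.

/-- Two vertices are linked if they are joined by an arc in one of the two directions. -/
def Linked {n : ℕ} (D : Digraph (Fin n)) (a b : Fin n) : Prop :=
  D.Adj a b ∨ D.Adj b a

theorem Linked.symm {n : ℕ} {D : Digraph (Fin n)} {a b : Fin n} (h : Linked D a b) :
    Linked D b a :=
  Or.symm h

theorem IsDAG.irrefl {n : ℕ} {D : Digraph (Fin n)} (hD : IsDAG D) (a : Fin n) : ¬ D.Adj a a :=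
  fun h => hD a (.single h)

theorem IsDAG.ne {n : ℕ} {D : Digraph (Fin n)} (hD : IsDAG D) {a b : Fin n} (h : D.Adj a b) :
    a ≠ b := by
  rintro rfl
  exact hD.irrefl _ h

theorem IsDAG.asymm {n : ℕ} {D : Digraph (Fin n)} (hD : IsDAG D) {a b : Fin n}
    (h : D.Adj a b) : ¬ D.Adj b a :=
  fun h' => hD a (.tail (.single h) h')

/-- The arc `x → y` is covered: `Pa(y) = Pa(x) ∪ {x}`. -/
def Covered {n : ℕ} (D : Digraph (Fin n)) (x y : Fin n) : Prop :=
  D.Adj x y ∧ ∀ z, D.Adj z y ↔ z = x ∨ D.Adj z x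

/-- The graph `D` with the arc `x → y` replaced by `y → x`. -/
def reversal {n : ℕ} (D : Digraph (Fin n)) (x y : Fin n) : Digraph (Fin n) where
  Adj a b := (D.Adj a b ∧ ¬ (a = x ∧ b = y)) ∨ (a = y ∧ b = x)

theorem reversal_adj {n : ℕ} {D : Digraph (Fin n)} {x y a b : Fin n} :
    (reversal D x y).Adj a b ↔ (D.Adj a b ∧ ¬ (a = x ∧ b = y)) ∨ (a = y ∧ b = x) :=
  Iff.rfl

theorem reversal_reversal {n : ℕ} {D : Digraph (Fin n)} (hD : IsDAG D) {x y : Fin n}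
    (h : D.Adj x y) : reversal (reversal D x y) y x = D := by
  have h' := hD.asymm h
  ext a b
  simp only [reversal_adj]
  constructor
  · rintro (⟨⟨h₁, -⟩ | h₁, h₂⟩ | ⟨rfl, rfl⟩)
    · exact h₁
    · exact absurd h₁ h₂
    · exact h
  · intro h₁
    by_cases h₂ : a = x ∧ b = y
    · exact Or.inr h₂
    · refine Or.inl ⟨Or.inl ⟨h₁, h₂⟩, ?_⟩
      rintro ⟨rfl, rfl⟩
      exact h' h₁

theorem Covered.reversal {n : ℕ} {D : Digraph (Fin n)} (hD : IsDAG D) {x y : Fin n}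
    (h : Covered D x y) : Covered (reversal D x y) y x := by
  have hne := hD.ne h.1
  have h' := hD.asymm h.1
  refine ⟨Or.inr ⟨rfl, rfl⟩, fun z => ?_⟩
  have hz := h.2 z
  have hx := hD.irrefl x
  simp only [reversal_adj]
  constructor
  · rintro (⟨h₁, -⟩ | ⟨rfl, -⟩)
    · exact Or.inr (Or.inl ⟨hz.2 (Or.inr h₁), fun h₂ => hD.ne h₁ h₂.1⟩)
    · exact Or.inl rfl
  · rintro (rfl | ⟨h₁, h₂⟩ | ⟨rfl, h₂⟩)
    · simp
    · rcases hz.1 h₁ with rfl | h₃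
      · simp at h₂
      · exact Or.inl ⟨h₃, fun h₄ => hne h₄.2⟩
    · exact absurd h₂.symm hne

theorem linked_reversal {n : ℕ} {D : Digraph (Fin n)} {x y : Fin n} (h : D.Adj x y)
    (a b : Fin n) : Linked (reversal D x y) a b ↔ Linked D a b := by
  simp only [Linked, reversal_adj]
  constructor
  · rintro ((⟨h₁, -⟩ | ⟨rfl, rfl⟩) | (⟨h₁, -⟩ | ⟨rfl, rfl⟩)) <;> tauto
  · rintro (h₁ | h₁)
    · by_cases h₂ : a = x ∧ b = y
      · exact Or.inr (Or.inr ⟨h₂.2, h₂.1⟩)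
      · exact Or.inl (Or.inl ⟨h₁, h₂⟩)
    · by_cases h₂ : b = x ∧ a = y
      · exact Or.inl (Or.inr ⟨h₂.2, h₂.1⟩)
      · exact Or.inr (Or.inl ⟨h₁, h₂⟩)

/-- The vertices of a DAG can be ranked along its arcs. -/
theorem isDAG_iff_exists_rank {n : ℕ} {D : Digraph (Fin n)} :
    IsDAG D ↔ ∃ f : Fin n → ℕ, ∀ a b, D.Adj a b → f a < f b := by
  constructor
  · intro hD
    refine ⟨fun v => {u | Relation.TransGen D.Adj u v}.ncard, fun a b hab => ?_⟩
    refine Set.ncard_lt_ncard ?_ (Set.toFinite _)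
    refine Set.ssubset_iff_of_subset (fun u (hu : Relation.TransGen _ _ _) => hu.tail hab) |>.2 ?_
    exact ⟨a, .single hab, hD a⟩
  · rintro ⟨f, hf⟩ v hv
    have : ∀ u w, Relation.TransGen D.Adj u w → f u < f w := by
      intro u w h
      induction h with
      | single h => exact hf _ _ h
      | tail _ h ih => exact ih.trans (hf _ _ h)
    exact lt_irrefl _ (this v v hv)

theorem Covered.isDAG_reversal {n : ℕ} {D : Digraph (Fin n)} (hD : IsDAG D) {x y : Fin n}
    (h : Covered D x y) : IsDAG (Shd3.reversal D x y) := by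
  have hxy := hD.ne h.1
  obtain ⟨f, hf⟩ := isDAG_iff_exists_rank.1 hD
  -- Doubling the ranks makes room to put `y` directly below `x`. This respects the arcs into `y`,
  -- since by coveredness their other tails are parents of `x`.
  refine isDAG_iff_exists_rank.2
    ⟨fun v => if v = y then 2 * f x else if v = x then 2 * f x + 1 else 2 * f v, ?_⟩
  have hfxy := hf _ _ h.1
  rintro a b (⟨h₁, h₂⟩ | ⟨rfl, rfl⟩)
  · have hfab := hf _ _ h₁
    by_cases hb : b = y
    · subst hb
      rcases (h.2 a).1 h₁ with rfl | h₃
      · exact absurd ⟨rfl, rfl⟩ h₂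
      · have := hf _ _ h₃
        have hax := hD.ne h₃
        have hab := hD.ne h₁
        simp only [hax, hab, if_true, if_false]
        lia
    · by_cases ha : a = y
      · subst ha
        have hbx : b ≠ x := by
          rintro rfl
          lia
        simp only [hb, hbx, if_true, if_false]
        lia
      · by_cases hbx : b = x
        · subst hbx
          simp only [ha, hb, hD.ne h₁, if_true, if_false]
          lia
        · simp only [ha, hb, hbx, if_false]
          split_ifs with hax
          · subst hax
            lia
          · lia
  · simp only [hxy, if_true, if_false]
    lia

/-! ### Separation and reachability -/

theorem exists_walk_avoiding_iff {n : ℕ} (M : SimpleGraph (Fin n)) (S : Set (Fin n))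
    (a b : Fin n) : (∃ p : M.Walk a b, ∀ s ∈ S, s ∉ p.support) ↔
      a ∉ S ∧ Relation.ReflTransGen (fun u v => M.Adj u v ∧ v ∉ S) a b := by
  constructor
  · rintro ⟨p, hp⟩
    induction p with
    | nil => exact ⟨fun h => hp _ h (by simp), .refl⟩
    | cons h p ih =>
      have h₁ := ih fun s hs hs' => hp s hs (by simp [hs'])
      exact ⟨fun h => hp _ h (by simp), .head ⟨h, h₁.1⟩ h₁.2⟩
  · rintro ⟨ha, h⟩
    induction h using Relation.ReflTransGen.head_induction_on with
    | refl => exact ⟨.nil, fun s hs hs' => ha (by simp at hs'; exact hs' ▸ hs)⟩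
    | head h _ ih =>
      obtain ⟨p, hp⟩ := ih h.2
      refine ⟨.cons h.1 p, fun s hs hs' => ?_⟩
      rcases List.mem_cons.1 (by simpa using hs') with rfl | h₁
      · exact ha hs
      · exact hp s hs h₁

theorem encodes_iff {n : ℕ} (D : Digraph (Fin n)) (A B S : Set (Fin n)) :
    Encodes D A B S ↔ ∀ a ∈ A, ∀ b ∈ B, a ∉ S →
      ¬ Relation.ReflTransGen (fun u v => (ancMoral D (A ∪ B ∪ S)).Adj u v ∧ v ∉ S) a b := by
  have := exists_walk_avoiding_iff (ancMoral D (A ∪ B ∪ S)) S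
  unfold Encodes
  refine forall₂_congr fun a _ => forall₂_congr fun b _ => ?_
  have := this a b
  rw [← not_and, ← this]
  push Not
  rfl

theorem subset_anc {n : ℕ} (D : Digraph (Fin n)) (W : Set (Fin n)) : W ⊆ anc D W :=
  fun w hw => ⟨w, hw, .refl⟩

theorem mem_anc_of_adj {n : ℕ} {D : Digraph (Fin n)} {W : Set (Fin n)} {u v : Fin n}
    (h : D.Adj u v) (hv : v ∈ anc D W) : u ∈ anc D W := by
  obtain ⟨w, hw, hvw⟩ := hv
  exact ⟨w, hw, .head h hvw⟩

/-- A directed path `u → x → y` can be shortened to `u → y`, as parents of `x` are parents of `y`.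
So the reversal can only cost `x` itself its place in the ancestral set. -/
theorem Covered.mem_anc_reversal {n : ℕ} {D : Digraph (Fin n)} (hD : IsDAG D) {x y : Fin n}
    (h : Covered D x y) {W : Set (Fin n)} {u : Fin n} (hu : u ∈ anc D W) :
    u ∈ anc (Shd3.reversal D x y) W ∨ (u = x ∧ y ∈ anc (Shd3.reversal D x y) W) := by
  obtain ⟨w, hw, huw⟩ := hu
  induction huw using Relation.ReflTransGen.head_induction_on with
  | refl => exact Or.inl (subset_anc _ _ hw)
  | @head u v h₁ _ ih =>
    by_cases h₂ : u = x ∧ v = y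
    · refine Or.inr ⟨h₂.1, ?_⟩
      rcases ih with h₃ | h₃
      · exact h₂.2 ▸ h₃
      · exact h₃.2
    · left
      rcases ih with h₃ | ⟨rfl, h₃⟩
      · exact mem_anc_of_adj (Or.inl ⟨h₁, h₂⟩) h₃
      · exact mem_anc_of_adj (Or.inl ⟨(h.2 u).2 (Or.inr h₁), fun h₄ => hD.ne h₁ h₄.1⟩) h₃

theorem Covered.encodes_of_reversal {n : ℕ} {D : Digraph (Fin n)} (hD : IsDAG D) {x y : Fin n}
    (h : Covered D x y) {A B S : Set (Fin n)} (hE : Encodes (Shd3.reversal D x y) A B S) :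
    Encodes D A B S := by
  have hxy := hD.ne h.1
  rw [encodes_iff] at hE ⊢
  intro a ha b hb haS hab
  refine hE a ha b hb haS ?_
  set W := A ∪ B ∪ S with hW
  set D' := Shd3.reversal D x y with hD'
  have haW : a ∈ W := Or.inl (Or.inl ha)
  have hbW : b ∈ W := Or.inl (Or.inr hb)
  have hanc : ∀ u ∈ anc D W, u ∈ anc D' W ∨ (u = x ∧ y ∈ anc D' W) :=
    fun u hu => h.mem_anc_reversal hD hu
  have hlink : ∀ u v, D.Adj u v ∨ D.Adj v u → D'.Adj u v ∨ D'.Adj v u :=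
    fun u v => (linked_reversal h.1 u v).2
  have hkeep : ∀ u v, D.Adj u v → u ≠ x → D'.Adj u v :=
    fun u v h₁ h₂ => Or.inl ⟨h₁, fun h₃ => h₂ h₃.1⟩
  have hpar : ∀ u, D.Adj u x → D'.Adj u y :=
    fun u hu => hkeep u y ((h.2 u).2 (Or.inr hu)) (hD.ne hu)
  -- If `x` drops out, its only child in the old ancestral set was `y`, so its moral neighbours were
  -- `y` and the parents of `x`. These are pairwise joined in the new moral graph, with common child
  -- `y`.
  by_cases hx : x ∈ anc D W ∧ x ∉ anc D' W
  · obtain ⟨hx, hx'⟩ := hx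
    have hy : y ∈ anc D' W := (hanc x hx).elim (fun h => absurd h hx') (·.2)
    have hanc' : ∀ u ∈ anc D W, u ≠ x → u ∈ anc D' W :=
      fun u hu hne => (hanc u hu).elim id fun h => absurd h.1 hne
    have hax : a ≠ x := by
      rintro rfl
      exact hx' (subset_anc _ _ haW)
    have hbx : b ≠ x := by
      rintro rfl
      exact hx' (subset_anc _ _ hbW)
    have hchild : ∀ c ∈ anc D W, D.Adj x c → c = y := by
      intro c hc hxc
      by_contra hcy
      exact hx' (mem_anc_of_adj (Or.inl ⟨hxc, fun h => hcy h.2⟩) (hanc' c hc (hD.ne hxc).symm))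
    have hnbr : ∀ u, (ancMoral D W).Adj u x → D.Adj u x ∨ u = y := by
      rintro u ⟨hne, hu, -, h₁ | h₁ | ⟨c, hc, h₁, h₂⟩⟩
      · exact Or.inl h₁
      · exact Or.inr (hchild u hu h₁)
      · obtain rfl := hchild c hc h₂
        exact Or.inl (((h.2 u).1 h₁).resolve_left hne)
    have hclique : ∀ u v, (D.Adj u x ∨ u = y) → (D.Adj v x ∨ v = y) → u ≠ v →
        (ancMoral D' W).Adj u v := by
      have hmem : ∀ u, D.Adj u x → u ∈ anc D' W := fun u hu => mem_anc_of_adj (hpar u hu) hy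
      rintro u v (hu | rfl) (hv | rfl) hne
      · exact ⟨hne, hmem u hu, hmem v hv, Or.inr (Or.inr ⟨y, hy, hpar u hu, hpar v hv⟩)⟩
      · exact ⟨hne, hmem u hu, hy, Or.inl (hpar u hu)⟩
      · exact ⟨hne, hy, hmem v hv, Or.inr (Or.inl (hpar v hv))⟩
      · exact absurd rfl hne
    have hstep : ∀ u v, (ancMoral D W).Adj u v → u ≠ x → v ≠ x → (ancMoral D' W).Adj u v := by
      rintro u v ⟨hne, hu, hv, h₁⟩ hux hvx
      refine ⟨hne, hanc' u hu hux, hanc' v hv hvx, ?_⟩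
      rcases h₁ with h₁ | h₁ | ⟨c, hc, h₁, h₂⟩
      · exact Or.inl (hkeep _ _ h₁ hux)
      · exact Or.inr (Or.inl (hkeep _ _ h₁ hvx))
      · by_cases hcx : c = x
        · subst hcx
          exact Or.inr (Or.inr ⟨y, hy, hpar u h₁, hpar v h₂⟩)
        · exact Or.inr (Or.inr ⟨c, hanc' c hc hcx, hkeep _ _ h₁ hux, hkeep _ _ h₂ hvx⟩)
    -- Invariant for bypassing `x`: while the old walk sits at `x`, the new one waits at some vertex
    -- of the clique.
    have hmain : ∀ v, Relation.ReflTransGen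
        (fun u v => (ancMoral D W).Adj u v ∧ v ∉ S) a v →
        (v ≠ x ∧ Relation.ReflTransGen (fun u v => (ancMoral D' W).Adj u v ∧ v ∉ S) a v) ∨
        (v = x ∧ ∃ u, (D.Adj u x ∨ u = y) ∧
          Relation.ReflTransGen (fun u v => (ancMoral D' W).Adj u v ∧ v ∉ S) a u) := by
      intro v hv
      induction hv with
      | refl => exact Or.inl ⟨hax, .refl⟩
      | @tail v w _ hvw ih =>
        by_cases hw : w = x
        · subst hw
          rcases ih with ⟨h₁, h₂⟩ | ⟨h₁, -⟩
          · exact Or.inr ⟨rfl, v, hnbr v hvw.1, h₂⟩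
          · exact absurd h₁ hvw.1.1
        · refine Or.inl ⟨hw, ?_⟩
          rcases ih with ⟨h₁, h₂⟩ | ⟨rfl, u, hu, h₂⟩
          · exact h₂.tail ⟨hstep v w hvw.1 h₁ hw, hvw.2⟩
          · by_cases huw : u = w
            · exact huw ▸ h₂
            · exact h₂.tail ⟨hclique u w hu (hnbr w hvw.1.symm) huw, hvw.2⟩
    exact ((hmain b hab).resolve_right fun h => hbx h.1).2
  · have hanc' : ∀ u ∈ anc D W, u ∈ anc D' W := by
      intro u hu
      rcases hanc u hu with h₁ | ⟨rfl, -⟩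
      · exact h₁
      · by_contra h₂
        exact hx ⟨hu, h₂⟩
    refine Relation.ReflTransGen.mono ?_ _ _ hab
    rintro u v ⟨⟨hne, hu, hv, h₁⟩, hvS⟩
    refine ⟨⟨hne, hanc' u hu, hanc' v hv, ?_⟩, hvS⟩
    rcases h₁ with h₁ | h₁ | ⟨c, hc, h₁, h₂⟩
    · rw [← or_assoc]
      exact Or.inl (hlink u v (Or.inl h₁))
    · rw [← or_assoc]
      exact Or.inl (hlink u v (Or.inr h₁))
    -- Only the common child `y` can be lost, and only when one of the two parents is `x`; the other
    -- is then a parent of `x`, hence still adjacent to it.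
    · by_cases hcy : c = y
      · subst hcy
        rcases (h.2 u).1 h₁ with rfl | h₃
        · have := ((h.2 v).1 h₂).resolve_left hne.symm
          rw [← or_assoc]
          exact Or.inl (hlink _ _ (Or.inr this))
        · rcases (h.2 v).1 h₂ with rfl | h₄
          · rw [← or_assoc]
            exact Or.inl (hlink _ _ (Or.inl h₃))
          · exact Or.inr (Or.inr ⟨c, hanc' c hc, hpar u h₃, hpar v h₄⟩)
      · exact Or.inr (Or.inr ⟨c, hanc' c hc, Or.inl ⟨h₁, fun h => hcy h.2⟩,
          Or.inl ⟨h₂, fun h => hcy h.2⟩⟩)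

theorem MarkovEquiv.symm {n : ℕ} {D D' : Digraph (Fin n)} (h : MarkovEquiv D D') :
    MarkovEquiv D' D :=
  fun A B S h₁ h₂ h₃ => (h A B S h₁ h₂ h₃).symm

theorem MarkovEquiv.trans {n : ℕ} {D D' D'' : Digraph (Fin n)} (h : MarkovEquiv D D')
    (h' : MarkovEquiv D' D'') : MarkovEquiv D D'' :=
  fun A B S h₁ h₂ h₃ => (h A B S h₁ h₂ h₃).trans (h' A B S h₁ h₂ h₃)

/-- Reversing a covered arc preserves the Markov equivalence class. -/
theorem Covered.markovEquiv_reversal {n : ℕ} {D : Digraph (Fin n)} (hD : IsDAG D)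
    {x y : Fin n} (h : Covered D x y) : MarkovEquiv D (Shd3.reversal D x y) := by
  intro A B S _ _ _
  refine ⟨fun hE => ?_, h.encodes_of_reversal hD⟩
  refine (h.reversal hD).encodes_of_reversal (h.isDAG_reversal hD) ?_
  rwa [reversal_reversal hD h.1]

theorem MarkovEquiv.cpdag_eq {n : ℕ} {D D' : Digraph (Fin n)} (h : MarkovEquiv D D') :
    cpdag D = cpdag D' := by
  unfold cpdag
  congr 1
  ext E
  exact ⟨fun hE => ⟨hE.1, h.symm.trans hE.2⟩, fun hE => ⟨hE.1, h.trans hE.2⟩⟩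

/-! ### Skeletons and v-structures -/

/-- `D` and `D'` have the same skeleton. -/
def SameSkeleton {n : ℕ} (D D' : Digraph (Fin n)) : Prop :=
  ∀ a b, Linked D a b ↔ Linked D' a b

/-- Every v-structure `a → c ← b` of `D` is a v-structure of `D'`. -/
def VStructuresLE {n : ℕ} (D D' : Digraph (Fin n)) : Prop :=
  ∀ a b c, D.Adj a c → D.Adj b c → a ≠ b → ¬ Linked D a b → D'.Adj a c

/-- The parents of `b` separate `b` from a non-adjacent non-descendant. -/
theorem encodes_parents {n : ℕ} {D : Digraph (Fin n)} {a b : Fin n}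
    (hne : a ≠ b) (hab : ¬ Linked D a b) (hanc : ¬ Relation.TransGen D.Adj b a)
    (hbb : ¬ Relation.TransGen D.Adj b b) :
    Encodes D {a} {b} {z | D.Adj z b} := by
  rw [encodes_iff]
  rintro a rfl b rfl _ h
  rcases Relation.ReflTransGen.cases_tail h with rfl | ⟨c, h₁, h₂, h₃⟩
  · exact hne rfl
  -- With no child of `b` in the ancestral set, every moral neighbour of `b` is a parent of `b`, so
  -- it lies in the separating set.
  have hchild : ∀ d ∈ anc D ({a} ∪ {b} ∪ {z | D.Adj z b}), ¬ D.Adj b d := by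
    rintro d ⟨w, (rfl | rfl) | hw, hdw⟩ hbd
    · exact hanc (.head' hbd hdw)
    · exact hbb (.head' hbd hdw)
    · exact hbb (.tail (.head' hbd hdw) hw)
  have hcb : D.Adj c b := by
    obtain ⟨-, h₄, -, h₅ | h₅ | ⟨d, hd, -, h₅⟩⟩ := h₂
    · exact h₅
    · exact absurd h₅ (hchild c h₄)
    · exact absurd h₅ (hchild d hd)
  rcases Relation.ReflTransGen.cases_tail h₁ with rfl | ⟨d, -, -, h₅⟩
  · exact hab (Or.inl hcb)
  · exact h₅ hcb

theorem not_encodes_of_linked {n : ℕ} {D : Digraph (Fin n)} {a b : Fin n} {S : Set (Fin n)}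
    (hne : a ≠ b) (hab : Linked D a b) (ha : a ∉ S) (hb : b ∉ S) : ¬ Encodes D {a} {b} S := by
  rw [encodes_iff]
  intro h
  refine h a rfl b rfl ha (.single ⟨⟨hne, ?_, ?_, ?_⟩, hb⟩)
  · exact subset_anc _ _ (by simp)
  · exact subset_anc _ _ (by simp)
  · rw [← or_assoc]
    exact Or.inl hab

/-- Two non-adjacent vertices of a DAG can be separated by the parents of one of them. -/
theorem exists_encodes {n : ℕ} {D : Digraph (Fin n)} (hD : IsDAG D) {a b : Fin n}
    (hne : a ≠ b) (hab : ¬ Linked D a b) :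
    ∃ S : Set (Fin n), a ∉ S ∧ b ∉ S ∧ (∀ c, D.Adj a c → D.Adj b c → c ∉ S) ∧
      (Encodes D {a} {b} S ∨ Encodes D {b} {a} S) := by
  by_cases h : Relation.TransGen D.Adj b a
  · refine ⟨{z | D.Adj z a}, hD.irrefl a, fun h' => hab (Or.inr h'), fun c hc _ => hD.asymm hc, ?_⟩
    exact Or.inr (encodes_parents hne.symm (fun h' => hab h'.symm)
      (fun h' => hD _ (h.trans h')) (hD a))
  · refine ⟨{z | D.Adj z b}, fun h' => hab (Or.inl h'), hD.irrefl b, fun c _ hc => hD.asymm hc, ?_⟩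
    exact Or.inl (encodes_parents hne hab h (hD b))

/-- The separator is built in `D` and used in `D'`. Stating both orders of the singletons avoids
needing symmetry of `Encodes`. -/
theorem MarkovEquiv.exists_encodes {n : ℕ} {D D' : Digraph (Fin n)} (hD : IsDAG D)
    (h : MarkovEquiv D D') {a b : Fin n} (hne : a ≠ b) (hab : ¬ Linked D a b) :
    ∃ S : Set (Fin n), a ∉ S ∧ b ∉ S ∧ (∀ c, D.Adj a c → D.Adj b c → c ∉ S) ∧
      (Encodes D' {a} {b} S ∨ Encodes D' {b} {a} S) := by
  obtain ⟨S, ha, hb, hc, hS⟩ := Shd3.exists_encodes hD hne hab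
  have ha' : Disjoint {a} S := Set.disjoint_singleton_left.2 ha
  have hb' : Disjoint {b} S := Set.disjoint_singleton_left.2 hb
  refine ⟨S, ha, hb, hc, hS.imp (fun hS => ?_) fun hS => ?_⟩
  · exact (h _ _ _ (by simpa using hne) ha' hb').1 hS
  · exact (h _ _ _ (by simpa using hne.symm) hb' ha').1 hS

/-- Adjacency is visible in the independences: non-adjacent vertices have a separator, adjacent ones
have none. -/
theorem MarkovEquiv.linked {n : ℕ} {D D' : Digraph (Fin n)} (hD : IsDAG D) (hD' : IsDAG D')
    (h : MarkovEquiv D D') {a b : Fin n} (hab : Linked D' a b) : Linked D a b := by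
  by_contra hn
  have hne : a ≠ b := by
    rintro rfl
    exact hab.elim (hD'.irrefl a) (hD'.irrefl a)
  obtain ⟨S, ha, hb, -, hS | hS⟩ := h.exists_encodes hD hne hn
  · exact not_encodes_of_linked hne hab ha hb hS
  · exact not_encodes_of_linked hne.symm hab.symm hb ha hS

theorem MarkovEquiv.sameSkeleton {n : ℕ} {D D' : Digraph (Fin n)} (hD : IsDAG D)
    (hD' : IsDAG D') (h : MarkovEquiv D D') : SameSkeleton D D' :=
  fun _ _ => ⟨h.symm.linked hD' hD, h.linked hD hD'⟩

/-- A non-collider `c` is an ancestor of `a` or `b`, so the walk through `c` exists in the moral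
graph and is blocked only by conditioning on `c`. -/
theorem not_encodes_of_noncollider {n : ℕ} {D : Digraph (Fin n)} (hD : IsDAG D)
    {a b c : Fin n} {S : Set (Fin n)} (hac : Linked D a c) (hcb : Linked D c b)
    (h : D.Adj c a ∨ D.Adj c b) (ha : a ∉ S) (hb : b ∉ S) (hc : c ∉ S) :
    ¬ Encodes D {a} {b} S := by
  have ne_of_linked : ∀ {u v}, Linked D u v → u ≠ v := fun h =>
    h.elim hD.ne fun h => (hD.ne h).symm
  rw [encodes_iff]
  intro hE
  have ha' : a ∈ anc D ({a} ∪ {b} ∪ S) := subset_anc _ _ (by simp)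
  have hb' : b ∈ anc D ({a} ∪ {b} ∪ S) := subset_anc _ _ (by simp)
  have hc' : c ∈ anc D ({a} ∪ {b} ∪ S) :=
    h.elim (fun h => mem_anc_of_adj h ha') fun h => mem_anc_of_adj h hb'
  refine hE a rfl b rfl ha (.tail (.single ⟨⟨ne_of_linked hac, ha', hc', ?_⟩, hc⟩)
    ⟨⟨ne_of_linked hcb, hc', hb', ?_⟩, hb⟩)
  · rw [← or_assoc]
    exact Or.inl hac
  · rw [← or_assoc]
    exact Or.inl hcb

/-- The separator of `a` and `b` taken from `D` omits their common child `c`; were `c` a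
non-collider in `D'`, it could not separate there. -/
theorem MarkovEquiv.vStructuresLE {n : ℕ} {D D' : Digraph (Fin n)} (hD : IsDAG D)
    (hD' : IsDAG D') (h : MarkovEquiv D D') : VStructuresLE D D' := by
  intro a b c hac hbc hne hab
  have hs := h.sameSkeleton hD hD'
  have hac' : Linked D' a c := (hs a c).1 (Or.inl hac)
  have hbc' : Linked D' b c := (hs b c).1 (Or.inl hbc)
  obtain ⟨S, ha, hb, hc, hS⟩ := h.exists_encodes hD hne hab
  by_contra hn
  have hca := hac'.resolve_left hn
  rcases hS with hS | hS
  · exact not_encodes_of_noncollider hD' hac' hbc'.symm (Or.inl hca) ha hb (hc c hac hbc) hS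
  · exact not_encodes_of_noncollider hD' hbc' hac'.symm (Or.inr hca) hb ha (hc c hac hbc) hS

theorem cpdag_adj {n : ℕ} {D : Digraph (Fin n)} {a b : Fin n} :
    (cpdag D).Adj a b ↔ ∃ E, IsDAG E ∧ MarkovEquiv D E ∧ E.Adj a b := by
  simp [cpdag, mec, Digraph.sSup_adj, and_assoc]

theorem cpdag_adj_of_adj {n : ℕ} {D : Digraph (Fin n)} (hD : IsDAG D) {a b : Fin n}
    (h : D.Adj a b) : (cpdag D).Adj a b :=
  cpdag_adj.2 ⟨D, hD, fun _ _ _ _ _ _ => Iff.rfl, h⟩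

theorem linked_cpdag {n : ℕ} {D : Digraph (Fin n)} (hD : IsDAG D) (a b : Fin n) :
    Linked (cpdag D) a b ↔ Linked D a b := by
  constructor
  · rintro (h | h)
    all_goals obtain ⟨E, hE, hDE, h⟩ := cpdag_adj.1 h
    · exact (hDE.sameSkeleton hD hE a b).2 (Or.inl h)
    · exact (hDE.sameSkeleton hD hE a b).2 (Or.inr h)
  · exact Or.imp (cpdag_adj_of_adj hD) (cpdag_adj_of_adj hD)

theorem sameSkeleton_of_cpdag_eq {n : ℕ} {D D' : Digraph (Fin n)} (hD : IsDAG D)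
    (hD' : IsDAG D') (h : cpdag D = cpdag D') : SameSkeleton D D' :=
  fun a b => by rw [← linked_cpdag hD, h, linked_cpdag hD']

/-- Equality of CPDAGs only says that each arc of `D'` occurs in some `E` equivalent to `D`. That
suffices: an arc `c → a` in `E` would contradict preservation of the v-structure from `D` to `E`. -/
theorem vStructuresLE_of_cpdag_eq {n : ℕ} {D D' : Digraph (Fin n)} (hD : IsDAG D)
    (hD' : IsDAG D') (h : cpdag D = cpdag D') : VStructuresLE D D' := by
  intro a b c hac hbc hne hab
  have hl : Linked D' a c := (sameSkeleton_of_cpdag_eq hD hD' h a c).1 (Or.inl hac)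
  refine hl.resolve_right fun hca => ?_
  have h₁ := cpdag_adj_of_adj hD' hca
  rw [← h] at h₁
  obtain ⟨E, hE, hDE, h₂⟩ := cpdag_adj.1 h₁
  exact hE.asymm h₂ (hDE.vStructuresLE hD hE a b c hac hbc hne hab)

/-! ### Chickering's theorem -/

/-- If two different DAGs have the same skeleton and the same v-structures, then some arc of the
first one that is reversed in the second one is covered. -/
theorem exists_covered {n : ℕ} {D D' : Digraph (Fin n)} (hD : IsDAG D) (hD' : IsDAG D')
    (hs : SameSkeleton D D') (hv : VStructuresLE D D') (hv' : VStructuresLE D' D)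
    (hne : ∃ a b, D.Adj a b ∧ D'.Adj b a) : ∃ x y, Covered D x y ∧ D'.Adj y x := by
  obtain ⟨f, hf⟩ := isDAG_iff_exists_rank.1 hD
  have hnl : ∀ {u v}, ¬ Linked D u v → ¬ Linked D' u v := fun h h' => h ((hs _ _).2 h')
  -- Choose `y` lowest among the heads of reversed arcs, then `x` highest among the tails of
  -- reversed arcs into `y`. Arcs with head below `y` thus agree in both DAGs.
  obtain ⟨y, ⟨x₀, hx₀⟩, hmin⟩ := Set.exists_min_image {y | ∃ x, D.Adj x y ∧ D'.Adj y x} f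
    (Set.toFinite _) (hne.elim fun a h => h.elim fun b h => ⟨b, a, h⟩)
  obtain ⟨x, ⟨hxy, hyx⟩, hmax⟩ := Set.exists_max_image {x | D.Adj x y ∧ D'.Adj y x} f
    (Set.toFinite _) ⟨x₀, hx₀⟩
  have hfxy := hf _ _ hxy
  have keep : ∀ {a b}, D.Adj a b → f b < f y → D'.Adj a b := fun h₁ h₂ =>
    ((hs _ _).1 (Or.inl h₁)).resolve_right fun h₃ => h₂.not_ge (hmin _ ⟨_, h₁, h₃⟩)
  refine ⟨x, y, ⟨hxy, fun z => ⟨fun hzy => ?_, ?_⟩⟩, hyx⟩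
  -- If `x → z`, then `D'` contains the cycle `y → x → z → y`; if `x` and `z` are not adjacent, the
  -- v-structure `x → y ← z` is lost in `D'`.
  · by_contra! hz
    obtain ⟨hzx, hz⟩ := hz
    by_cases hl : Linked D x z
    · have hxz := hl.resolve_right hz
      have hfz := hf _ _ hzy
      have h₁ : D'.Adj z y := ((hs _ _).1 (Or.inl hzy)).resolve_right fun h₂ =>
        (hf _ _ hxz).not_ge (hmax _ ⟨hzy, h₂⟩)
      exact hD' y (.tail (.tail (.single hyx) (keep hxz hfz)) h₁)
    · exact hD'.asymm hyx (hv x z y hxy hzy hzx.symm hl)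
  -- If `z` and `y` were not adjacent, `y → x ← z` would be a v-structure of `D'` only.
  · rintro (rfl | hzx)
    · exact hxy
    · have hfz := hf _ _ hzx
      by_cases hl : Linked D z y
      · refine hl.resolve_right fun h₁ => ?_
        have := hf _ _ h₁
        lia
      · have h₁ := keep hzx hfxy
        have hzy : z ≠ y := by
          rintro rfl
          lia
        exact absurd (hv' y z x hyx h₁ hzy.symm fun h => hnl hl h.symm) (hD.asymm hxy)

/-- `E` arises from `D` by reversing a covered arc. -/
def CoveredStep {n : ℕ} (D E : Digraph (Fin n)) : Prop :=
  ∃ x y, Covered D x y ∧ E = reversal D x y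

theorem Covered.cpdag_reversal {n : ℕ} {D : Digraph (Fin n)} (hD : IsDAG D) {x y : Fin n}
    (h : Covered D x y) : cpdag (Shd3.reversal D x y) = cpdag D :=
  (h.markovEquiv_reversal hD).cpdag_eq.symm

theorem CoveredStep.mem_dags {n : ℕ} {G D E : Digraph (Fin n)} (hD : D ∈ dags G)
    (h : CoveredStep D E) : E ∈ dags G := by
  obtain ⟨x, y, h, rfl⟩ := h
  exact ⟨h.isDAG_reversal hD.1, (h.cpdag_reversal hD.1).trans hD.2⟩

theorem eq_of_sameSkeleton {n : ℕ} {D D' : Digraph (Fin n)}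
    (hs : SameSkeleton D D') (h : ¬ ∃ a b, D.Adj a b ∧ D'.Adj b a) : D = D' := by
  push Not at h
  ext a b
  constructor
  · exact fun h₁ => ((hs a b).1 (Or.inl h₁)).resolve_right (h _ _ h₁)
  · exact fun h₁ => ((hs a b).2 (Or.inl h₁)).resolve_right fun h₂ => h _ _ h₂ h₁

/-- The DAGs of a Markov equivalence class are connected by reversals of covered arcs. -/
theorem reflTransGen_coveredStep {n : ℕ} {G D D' : Digraph (Fin n)} (hD : D ∈ dags G)
    (hD' : D' ∈ dags G) : Relation.ReflTransGen CoveredStep D D' := by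
  -- The measure is the number of arcs on which `D` and `D'` disagree.
  induction hk : {p : Fin n × Fin n | D.Adj p.1 p.2 ∧ D'.Adj p.2 p.1}.ncard
    using Nat.strong_induction_on generalizing D with
  | _ k ih =>
    have he : cpdag D = cpdag D' := hD.2.trans hD'.2.symm
    have hs := sameSkeleton_of_cpdag_eq hD.1 hD'.1 he
    by_cases hne : ∃ a b, D.Adj a b ∧ D'.Adj b a
    · obtain ⟨x, y, hc, hyx⟩ := exists_covered hD.1 hD'.1 hs
        (vStructuresLE_of_cpdag_eq hD.1 hD'.1 he) (vStructuresLE_of_cpdag_eq hD'.1 hD.1 he.symm) hne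
      have hstep : CoveredStep D (reversal D x y) := ⟨x, y, hc, rfl⟩
      refine .head hstep (ih _ ?_ (hstep.mem_dags hD) rfl)
      rw [← hk]
      refine Set.ncard_lt_ncard ?_ (Set.toFinite _)
      refine Set.ssubset_iff_of_subset ?_ |>.2 ⟨(x, y), ⟨hc.1, hyx⟩, ?_⟩
      · rintro ⟨a, b⟩ ⟨⟨h₁, -⟩ | ⟨rfl, rfl⟩, h₂⟩
        · exact ⟨h₁, h₂⟩
        · exact absurd h₂ (hD'.1.asymm hyx)
      · rintro ⟨⟨-, h₁⟩ | ⟨h₁, -⟩, -⟩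
        · exact h₁ ⟨rfl, rfl⟩
        · exact hD.1.ne hc.1 h₁
    · rw [eq_of_sameSkeleton hs hne]

/-! ### Running time of the subroutines -/

/-- The program `p` returns `a` within `t` steps and changes nothing but the clock. -/
def Computes {n : ℕ} {α : Type} (p : Prog n α) (a : α) (t : ℕ) : Prop :=
  ∀ s, ∃ k ≤ t, p s = some (a, { s with clock := s.clock + k })

theorem bind_run {n : ℕ} {α β : Type} {p : Prog n α} {f : α → Prog n β} {s s' : State n} {a : α}
    (h : p s = some (a, s')) : (p >>= f) s = f a s' := by
  change (p s >>= fun q => f q.1 q.2) = _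
  rw [h]
  rfl

theorem Computes.pure {n : ℕ} {α : Type} (a : α) : Computes (n := n) (pure a) a 0 :=
  fun _ => ⟨0, le_rfl, rfl⟩

theorem Computes.tick {n : ℕ} : Computes (n := n) tick () 1 :=
  fun _ => ⟨1, le_rfl, rfl⟩

theorem Computes.bind {n : ℕ} {α β : Type} {p : Prog n α} {f : α → Prog n β} {a : α} {b : β}
    {t u : ℕ} (hp : Computes p a t) (hf : Computes (f a) b u) :
    Computes (p >>= f) b (t + u) := by
  intro s
  obtain ⟨k, hk, h⟩ := hp s
  obtain ⟨l, hl, h'⟩ := hf { s with clock := s.clock + k }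
  refine ⟨k + l, add_le_add hk hl, ?_⟩
  rw [bind_run h, h']
  simp [add_assoc]

theorem Computes.mono {n : ℕ} {α : Type} {p : Prog n α} {a : α} {t u : ℕ}
    (hp : Computes p a t) (h : t ≤ u) : Computes p a u := by
  intro s
  obtain ⟨k, hk, h'⟩ := hp s
  exact ⟨k, hk.trans h, h'⟩

theorem Computes.map {n : ℕ} {α β : Type} {p : Prog n α} {a : α} {t : ℕ} (hp : Computes p a t)
    (g : α → β) : Computes (g <$> p) (g a) t := by
  rw [map_eq_pure_bind]
  exact hp.bind (f := fun a => Pure.pure (g a)) (.pure _)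

theorem Computes.tick_bind {n : ℕ} {α : Type} {f : Unit → Prog n α} {a : α} {t : ℕ}
    (h : Computes (f ()) a t) : Computes (Shd3.tick >>= f) a (t + 1) :=
  (Computes.tick.bind h).mono (by lia)

/-- The parents of `v` in the order in which they are stored. -/
def parentList {n : ℕ} (D : Arcs n) (v : Fin n) : List (Fin n) :=
  (D.filter fun e => e.2 = v).map Prod.fst

theorem mem_parentList {n : ℕ} {D : Arcs n} {v u : Fin n} : u ∈ parentList D v ↔ (u, v) ∈ D := by
  simp [parentList]

theorem length_parentList_le {n : ℕ} (D : Arcs n) (v : Fin n) :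
    (parentList D v).length ≤ D.length := by
  simpa [parentList] using List.length_filter_le _ D

/-- For arcs with a common head, the order of the edges is the order of the tails. Parent lists
therefore need no sorting, which keeps the covered test linear. -/
theorem Sorted.parentList {n : ℕ} {D : Arcs n} (h : Sorted D) (v : Fin n) :
    (parentList D v).Pairwise (· < ·) := by
  rw [Shd3.parentList, List.pairwise_map]
  refine (h.filter _).imp_of_mem ?_
  rintro ⟨a, c⟩ ⟨b, d⟩ ha hb hab
  obtain rfl : c = v := by simpa using (List.mem_filter.1 ha).2
  obtain rfl : d = c := by simpa using (List.mem_filter.1 hb).2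
  by_contra hba
  simp only [not_lt] at hba
  simp only [min_def, max_def] at hab
  split_ifs at hab <;> lia

theorem computes_parents {n : ℕ} (D : Arcs n) (v : Fin n) :
    Computes (parents D v) (parentList D v) (D.length + 1) := by
  induction D with
  | nil => exact Computes.tick_bind (.pure _)
  | cons e D ih =>
    obtain ⟨a, b⟩ := e
    refine Computes.tick_bind ((ih.bind (u := 0) ?_).mono le_rfl)
    by_cases hb : b = v
    · simpa [hb, parentList] using Computes.pure _
    · simpa [hb, parentList] using Computes.pure _

theorem computes_insertSorted {n : ℕ} (x : Fin n) {l : List (Fin n)}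
    (hl : l.Pairwise (· < ·)) : ∃ l', Computes (insertSorted x l) l' (l.length + 1) ∧
      l'.length ≤ l.length + 1 ∧ l'.Pairwise (· < ·) ∧ ∀ z, z ∈ l' ↔ z = x ∨ z ∈ l := by
  induction l with
  | nil => exact ⟨[x], Computes.tick_bind (.pure _), by simp, by simp, by simp⟩
  | cons a l ih =>
    rw [List.pairwise_cons] at hl
    rcases lt_trichotomy x a with hxa | rfl | hax
    · refine ⟨x :: a :: l, Computes.tick_bind ?_, by simp, ?_, by simp⟩
      · simpa [hxa] using (Computes.pure _).mono (Nat.zero_le _)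
      · simp only [List.pairwise_cons, List.mem_cons]
        refine ⟨?_, hl⟩
        rintro b (rfl | hb)
        · exact hxa
        · exact hxa.trans (hl.1 b hb)
    · refine ⟨x :: l, Computes.tick_bind ?_, by simp, List.pairwise_cons.2 hl, by simp⟩
      simpa using (Computes.pure _).mono (Nat.zero_le _)
    · obtain ⟨l', h₁, h₂, h₃, h₄⟩ := ih hl.2
      refine ⟨a :: l', Computes.tick_bind ?_, by simpa using h₂, ?_, fun z => ?_⟩
      · simpa [hax.not_gt, hax.ne'] using h₁.map _
      · refine List.pairwise_cons.2 ⟨fun b hb => ?_, h₃⟩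
        rcases (h₄ b).1 hb with rfl | hb
        · exact hax
        · exact hl.1 b hb
      · simp [h₄, or_left_comm]

theorem computes_eqLists {n : ℕ} (l k : List (Fin n)) :
    Computes (eqLists l k) (decide (l = k)) (l.length + 1) := by
  induction l generalizing k with
  | nil =>
    cases k with
    | nil => exact Computes.tick_bind (.pure _)
    | cons b k => exact Computes.tick_bind (by simpa using .pure _)
  | cons a l ih =>
    cases k with
    | nil => exact (Computes.tick_bind (t := 0) (by simpa using .pure _)).mono (by simp)
    | cons b k =>
      refine Computes.tick_bind ?_
      by_cases h : a = b
      · simpa [h] using ih k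
      · simpa [h] using (Computes.pure _).mono (Nat.zero_le _)

theorem eq_iff_of_pairwise_lt {n : ℕ} {l k : List (Fin n)} (hl : l.Pairwise (· < ·))
    (hk : k.Pairwise (· < ·)) : l = k ↔ ∀ z, z ∈ l ↔ z ∈ k := by
  refine ⟨fun h z => by rw [h], fun h => ?_⟩
  exact ((List.perm_ext_iff_of_nodup (hl.imp ne_of_lt) (hk.imp ne_of_lt)).2 h).eq_of_pairwise
    (fun a b _ _ hab hba => absurd hab hba.not_gt) hl hk

theorem computes_isCovered {n : ℕ} {D : Arcs n} (hD : Sorted D) (x y : Fin n) :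
    ∃ b, Computes (isCovered D x y) b (4 * D.length + 6) ∧
      (b = true ↔ ∀ z, (z, y) ∈ D ↔ z = x ∨ (z, x) ∈ D) := by
  obtain ⟨l, h₁, h₂, h₃, h₄⟩ := computes_insertSorted x (hD.parentList x)
  have hlen := length_parentList_le D x
  -- One call, two scans and an insertion of at most `m + 1` steps each, and a comparison of at most
  -- `m + 2` steps.
  refine ⟨_, (Computes.tick_bind ((computes_parents D x).bind (h₁.bind
    ((computes_parents D y).bind (computes_eqLists l _))))).mono (by lia), ?_⟩
  rw [decide_eq_true_iff, eq_iff_of_pairwise_lt h₃ (hD.parentList y)]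
  simp only [h₄, mem_parentList]
  exact forall_congr' fun z => iff_comm

/-- Reverse all copies of the arc `x → y`. -/
def flip {n : ℕ} (x y : Fin n) (D : Arcs n) : Arcs n :=
  D.map fun e => if e.1 = x ∧ e.2 = y then (e.2, e.1) else e

theorem computes_reverseArc {n : ℕ} (x y : Fin n) (D : Arcs n) :
    Computes (reverseArc x y D) (flip x y D) (D.length + 1) := by
  induction D with
  | nil => exact Computes.tick_bind (.pure _)
  | cons e D ih =>
    obtain ⟨a, b⟩ := e
    refine Computes.tick_bind ((ih.bind (u := 0) ?_).mono le_rfl)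
    by_cases h : a = x ∧ b = y
    · simpa [h, flip] using Computes.pure _
    · simpa [h, flip] using Computes.pure _

/-- The orientations of the arcs. -/
def key {n : ℕ} (D : Arcs n) : List Bool :=
  D.map fun e => decide (e.1 < e.2)

/-- The path from the root of the trie does not run into `empty`. -/
def Trie.Mem : Trie → List Bool → Prop
  | .empty, _ => False
  | .node _ _, [] => True
  | .node l r, b :: k => if b then l.Mem k else r.Mem k

theorem computes_lookup {n : ℕ} (t : Trie) (D : Arcs n) :
    ∃ b, Computes (lookup t D) b (D.length + 1) ∧ (b = true ↔ t.Mem (key D)) := by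
  induction D generalizing t with
  | nil =>
    cases t with
    | empty => exact ⟨_, Computes.tick_bind (.pure _), by simp [Trie.Mem]⟩
    | node l r => exact ⟨_, Computes.tick_bind (.pure _), by simp [Trie.Mem, key]⟩
  | cons e D ih =>
    obtain ⟨a, b⟩ := e
    cases t with
    | empty =>
      exact ⟨false, (Computes.tick_bind (f := fun _ => pure false) (.pure _)).mono (by simp),
        by simp [Trie.Mem]⟩
    | node l r =>
      by_cases h : a < b
      · obtain ⟨c, h₁, h₂⟩ := ih l
        refine ⟨c, Computes.tick_bind ?_, ?_⟩
        · simpa [h] using h₁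
        · simpa [h, key, Trie.Mem] using h₂
      · obtain ⟨c, h₁, h₂⟩ := ih r
        refine ⟨c, Computes.tick_bind ?_, ?_⟩
        · simpa [h] using h₁
        · simpa [h, key, Trie.Mem] using h₂

/-- The length restriction matters: `Trie.Mem` also accepts every prefix of an inserted key. -/
theorem computes_insertKey {n : ℕ} (D : Arcs n) (t : Trie) :
    ∃ t', Computes (insertKey D t) t' (D.length + 1) ∧
      ∀ k : List Bool, k.length = D.length → (t'.Mem k ↔ k = key D ∨ t.Mem k) := by
  induction D generalizing t with
  | nil =>
    cases t with
    | empty =>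
      refine ⟨_, Computes.tick_bind (.pure _), fun k hk => ?_⟩
      obtain rfl := List.length_eq_zero_iff.1 hk
      simp [Trie.Mem, key]
    | node l r =>
      refine ⟨_, Computes.tick_bind (.pure _), fun k hk => ?_⟩
      obtain rfl := List.length_eq_zero_iff.1 hk
      simp [Trie.Mem, key]
  | cons e D ih =>
    obtain ⟨a, b⟩ := e
    cases t with
    | empty =>
      obtain ⟨t', h₁, h₂⟩ := ih .empty
      by_cases h : a < b
      · refine ⟨.node t' .empty, Computes.tick_bind ?_, fun k hk => ?_⟩
        · simpa [h] using h₁.map _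
        · cases k with
          | nil => simp at hk
          | cons c k =>
            have := h₂ k (by simpa using hk)
            cases c <;> simp_all [Trie.Mem, key]
      · refine ⟨.node .empty t', Computes.tick_bind ?_, fun k hk => ?_⟩
        · simpa [h] using h₁.map _
        · cases k with
          | nil => simp at hk
          | cons c k =>
            have := h₂ k (by simpa using hk)
            cases c <;> simp_all [Trie.Mem, key]
    | node l r =>
      by_cases h : a < b
      · obtain ⟨t', h₁, h₂⟩ := ih l
        refine ⟨.node t' r, Computes.tick_bind ?_, fun k hk => ?_⟩
        · simpa [h] using h₁.map _
        · cases k with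
          | nil => simp at hk
          | cons c k =>
            have := h₂ k (by simpa using hk)
            cases c <;> simp_all [Trie.Mem, key]
      · obtain ⟨t', h₁, h₂⟩ := ih r
        refine ⟨.node l t', Computes.tick_bind ?_, fun k hk => ?_⟩
        · simpa [h] using h₁.map _
        · cases k with
          | nil => simp at hk
          | cons c k =>
            have := h₂ k (by simpa using hk)
            cases c <;> simp_all [Trie.Mem, key]

theorem isVisited_run {n : ℕ} (D : Arcs n) (s : State n) :
    ∃ b, ∃ k ≤ D.length + 2, isVisited D s = some (b, { s with clock := s.clock + k }) ∧
      (b = true ↔ s.vis.Mem (key D)) := by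
  obtain ⟨b, h₁, h₂⟩ := computes_lookup s.vis D
  obtain ⟨k, hk, h⟩ := h₁ { s with clock := s.clock + 1 }
  refine ⟨b, 1 + k, by lia, ?_, h₂⟩
  have h₃ : isVisited D s = lookup s.vis D { s with clock := s.clock + 1 } := rfl
  rw [h₃, h]
  simp [add_assoc]

theorem markVisited_run {n : ℕ} (D : Arcs n) (s : State n) :
    ∃ t, ∃ k ≤ D.length + 2, markVisited D s = some ((), ⟨t, s.clock + k, s.log⟩) ∧
      ∀ l : List Bool, l.length = D.length → (t.Mem l ↔ l = key D ∨ s.vis.Mem l) := by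
  obtain ⟨t, h₁, h₂⟩ := computes_insertKey D s.vis
  obtain ⟨k, hk, h⟩ := h₁ { s with clock := s.clock + 1 }
  refine ⟨t, 1 + k, by lia, ?_, h₂⟩
  have h₃ : markVisited D s = (insertKey D s.vis >>= fun t =>
      modify fun s => { s with vis := t }) { s with clock := s.clock + 1 } := rfl
  rw [h₃, bind_run h, ← add_assoc]
  rfl

theorem computes_writeArcs {n : ℕ} (D : Arcs n) : Computes (writeArcs D) () (D.length + 1) := by
  induction D with
  | nil => exact Computes.tick
  | cons e D ih => exact Computes.tick_bind ih

theorem output_run {n : ℕ} (D : Arcs n) (s : State n) :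
    ∃ k ≤ D.length + 2, output D s =
      some ((), ⟨s.vis, s.clock + k, s.log ++ [(D, s.clock + k)]⟩) := by
  obtain ⟨k, hk, h⟩ := Computes.tick_bind (f := fun _ => writeArcs D) (computes_writeArcs D) s
  refine ⟨k, hk, ?_⟩
  have h₃ : output D s = ((tick >>= fun _ => writeArcs D) >>= fun _ =>
      modify fun s => { s with log := s.log ++ [(D, s.clock)] }) s := rfl
  rw [h₃, bind_run h]
  rfl

/-! ### Structural Hamming distance -/

theorem shd_self {n : ℕ} (D : Digraph (Fin n)) : shd D D = 0 := by
  simp [shd]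

theorem shd_comm {n : ℕ} (D E : Digraph (Fin n)) : shd D E = shd E D := by
  unfold shd
  congr 1
  ext p
  simp only [Set.mem_ofPred_eq]
  tauto

theorem shd_triangle {n : ℕ} (D E F : Digraph (Fin n)) : shd D F ≤ shd D E + shd E F := by
  unfold shd
  refine (Set.ncard_le_ncard ?_ (Set.toFinite _)).trans (Set.ncard_union_le _ _)
  intro p
  simp only [Set.mem_ofPred_eq, Set.mem_union]
  tauto

/-- The end vertices of an arc in increasing order. -/
def edge {n : ℕ} (e : Fin n × Fin n) : Fin n × Fin n :=
  (min e.1 e.2, max e.1 e.2)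

theorem edge_swap {n : ℕ} (a b : Fin n) : edge (a, b) = edge (b, a) := by
  simp [edge, min_comm, max_comm]

theorem edge_of_le {n : ℕ} {a b : Fin n} (h : a ≤ b) : edge (a, b) = (a, b) := by
  simp [edge, h]

theorem shd_reversal_le_one {n : ℕ} (D : Digraph (Fin n)) (x y : Fin n) :
    shd D (reversal D x y) ≤ 1 := by
  unfold shd
  rw [← Set.ncard_singleton (edge (x, y))]
  refine Set.ncard_le_ncard ?_ (Set.toFinite _)
  rintro ⟨a, b⟩ ⟨hab, h⟩
  rw [Set.mem_singleton_iff, ← edge_of_le hab]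
  by_contra hne
  have h₁ : ¬ (a = x ∧ b = y) := by
    rintro ⟨rfl, rfl⟩
    exact hne rfl
  have h₂ : ¬ (a = y ∧ b = x) := by
    rintro ⟨rfl, rfl⟩
    exact hne (edge_swap _ _)
  refine h ⟨?_, ?_⟩ <;> simp only [reversal_adj] <;> tauto

/-! ### Stored DAGs with the same edges -/

/-- The edges in the order in which they are stored. -/
def shape {n : ℕ} (D : Arcs n) : Arcs n :=
  D.map edge

theorem sorted_iff_shape {n : ℕ} (D : Arcs n) : Sorted D ↔
    (shape D).Pairwise fun e f => e.1 < f.1 ∨ (e.1 = f.1 ∧ e.2 < f.2) := by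
  rw [shape, List.pairwise_map]
  rfl

theorem length_eq_of_shape_eq {n : ℕ} {D E : Arcs n} (h : shape D = shape E) :
    D.length = E.length := by
  simpa [shape] using congrArg List.length h

theorem shape_flip {n : ℕ} (x y : Fin n) (D : Arcs n) : shape (flip x y D) = shape D := by
  rw [shape, shape, flip, List.map_map]
  refine List.map_congr_left fun e _ => ?_
  simp only [Function.comp_apply]
  split_ifs
  · exact edge_swap _ _
  · rfl

theorem ofArcs_flip {n : ℕ} {x y : Fin n} {D : Arcs n} (h : (x, y) ∈ D) :
    ofArcs (flip x y D) = reversal (ofArcs D) x y := by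
  ext a b
  simp only [ofArcs, flip, reversal_adj, List.mem_map]
  constructor
  · rintro ⟨e, he, h₁⟩
    split_ifs at h₁ with h₂
    · simp only [Prod.mk.injEq] at h₁
      exact Or.inr ⟨h₁.1.symm.trans h₂.2, h₁.2.symm.trans h₂.1⟩
    · subst h₁
      exact Or.inl ⟨he, h₂⟩
  · rintro (⟨h₁, h₂⟩ | ⟨rfl, rfl⟩)
    · exact ⟨(a, b), h₁, by simp only [h₂, if_false]⟩
    · exact ⟨_, h, by simp⟩

/-- Smaller end, larger end and orientation bit determine an arc, so keys are faithful among
orientations of one edge list. -/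
theorem eq_of_key_eq {n : ℕ} {D E : Arcs n} (hs : shape D = shape E) (hk : key D = key E) :
    D = E := by
  induction D generalizing E with
  | nil =>
    cases E with
    | nil => rfl
    | cons f E => simp [key] at hk
  | cons e D ih =>
    cases E with
    | nil => simp [key] at hk
    | cons f E =>
      obtain ⟨a, b⟩ := e
      obtain ⟨c, d⟩ := f
      simp only [shape, key, edge, List.map_cons, List.cons.injEq, Prod.mk.injEq,
        decide_eq_decide] at hs hk
      rw [ih hs.2 hk.2]
      obtain ⟨⟨h₁, h₂⟩, -⟩ := hs
      have h₃ := hk.1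
      simp only [min_def, max_def] at h₁ h₂
      have : a = c ∧ b = d := by
        split_ifs at h₁ h₂ <;> lia
      rw [this.1, this.2]

theorem Sorted.nodup_shape {n : ℕ} {D : Arcs n} (h : Sorted D) : (shape D).Nodup := by
  refine ((sorted_iff_shape D).1 h).imp ?_
  rintro e _ h rfl
  simp at h

theorem eq_of_ofArcs_eq {n : ℕ} {D E : Arcs n} (hD : Sorted D) (hE : Sorted E)
    (h : ofArcs D = ofArcs E) : D = E := by
  refine ((List.perm_ext_iff_of_nodup hD.nodup_shape.of_map hE.nodup_shape.of_map).2
    fun e => ?_).eq_of_pairwise ?_ hD hE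
  · have := congrArg (fun H => H.Adj e.1 e.2) h
    exact iff_of_eq this
  · intro e f _ _ h₁ h₂
    exfalso
    lia

theorem numEdges_eq_length {n : ℕ} {G : Digraph (Fin n)} {L : Arcs n} (hL : Sorted L)
    (hG : ofArcs L ∈ dags G) : numEdges G = L.length := by
  have h : {p : Fin n × Fin n | p.1 ≤ p.2 ∧ (G.Adj p.1 p.2 ∨ G.Adj p.2 p.1)} =
      ((shape L).toFinset : Set (Fin n × Fin n)) := by
    ext ⟨a, b⟩
    have h₁ : (G.Adj a b ∨ G.Adj b a) ↔ ((a, b) ∈ L ∨ (b, a) ∈ L) := by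
      rw [← hG.2]
      exact linked_cpdag hG.1 a b
    simp only [Set.mem_ofPred_eq, h₁, List.coe_toFinset, shape, List.mem_map]
    constructor
    · rintro ⟨hab, h₂ | h₂⟩
      · exact ⟨_, h₂, edge_of_le hab⟩
      · exact ⟨_, h₂, by rw [edge_swap, edge_of_le hab]⟩
    · rintro ⟨⟨c, d⟩, h₂, h₃⟩
      rcases le_total c d with hcd | hcd
      · rw [edge_of_le hcd, Prod.mk.injEq] at h₃
        obtain ⟨rfl, rfl⟩ := h₃
        exact ⟨hcd, Or.inl h₂⟩
      · rw [edge_swap, edge_of_le hcd, Prod.mk.injEq] at h₃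
        obtain ⟨rfl, rfl⟩ := h₃
        exact ⟨hcd, Or.inr h₂⟩
  rw [numEdges, h, Set.ncard_coe_finset, List.toFinset_card_of_nodup hL.nodup_shape]
  simp [shape]

/-- The stored forms of the DAGs in `[G]` that have the same list of edges as `L`. -/
def members {n : ℕ} (G : Digraph (Fin n)) (L : Arcs n) : Set (Arcs n) :=
  {D | shape D = shape L ∧ ofArcs D ∈ dags G}

theorem members_finite {n : ℕ} (G : Digraph (Fin n)) (L : Arcs n) : (members G L).Finite :=
  (List.finite_length_eq (Fin n × Fin n) L.length).subset fun _ hD => length_eq_of_shape_eq hD.1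

theorem sorted_of_mem_members {n : ℕ} {G : Digraph (Fin n)} {L D : Arcs n} (hL : Sorted L)
    (hD : D ∈ members G L) : Sorted D := by
  rw [sorted_iff_shape, hD.1, ← sorted_iff_shape]
  exact hL

theorem flip_mem_members {n : ℕ} {G : Digraph (Fin n)} {L D : Arcs n} (hD : D ∈ members G L)
    {x y : Fin n} (h : Covered (ofArcs D) x y) : flip x y D ∈ members G L := by
  refine ⟨(shape_flip x y D).trans hD.1, ?_⟩
  rw [ofArcs_flip h.1]
  exact CoveredStep.mem_dags hD.2 ⟨x, y, h, rfl⟩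

theorem shd_flip_le_one {n : ℕ} {D : Arcs n} {x y : Fin n} (h : Covered (ofArcs D) x y) :
    shd (ofArcs D) (ofArcs (flip x y D)) ≤ 1 := by
  rw [ofArcs_flip h.1]
  exact shd_reversal_le_one _ _ _

/-- The members that are held by a trie. -/
def seen {n : ℕ} (G : Digraph (Fin n)) (L : Arcs n) (t : Trie) : Set (Arcs n) :=
  {D | D ∈ members G L ∧ t.Mem (key D)}

theorem seen_eq_insert {n : ℕ} {G : Digraph (Fin n)} {L D : Arcs n} (hD : D ∈ members G L)
    {t t' : Trie}
    (h : ∀ l : List Bool, l.length = D.length → (t'.Mem l ↔ l = key D ∨ t.Mem l)) :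
    seen G L t' = insert D (seen G L t) := by
  ext E
  simp only [seen, Set.mem_ofPred_eq, Set.mem_insert_iff]
  have hlen : E ∈ members G L → (key E).length = D.length := fun hE => by
    simpa [key] using length_eq_of_shape_eq (hE.1.trans hD.1.symm)
  constructor
  · rintro ⟨hE, h₁⟩
    rcases (h _ (hlen hE)).1 h₁ with h₂ | h₂
    · exact Or.inl (eq_of_key_eq (hE.1.trans hD.1.symm) h₂)
    · exact Or.inr ⟨hE, h₂⟩
  · rintro (rfl | ⟨hE, h₁⟩)
    · exact ⟨hD, (h _ (hlen hD)).2 (Or.inl rfl)⟩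
    · exact ⟨hE, (h _ (hlen hE)).2 (Or.inr h₁)⟩

/-! ### The depth-first search -/

/-- A bound for the time of one iteration of the loop, without recursive calls. -/
def iterCost (m : ℕ) : ℕ := 7 * m + 20

/-- A bound for the time of `k` iterations of the loop, without recursive calls. -/
def loopCost (m k : ℕ) : ℕ := k * iterCost m + 1

/-- A bound for the time from a call of `enumerate` at depth `i` to its first output, and also for
the time from the last output of a call at depth `i + 1` to its end. -/
def latency (m i : ℕ) : ℕ := if i % 2 = 0 then m + 5 else loopCost m m + m + 6

/-- A bound for the time between two outputs. -/
def maxDelay (m : ℕ) : ℕ := loopCost m m + latency m 0 + latency m 1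

/-- Consecutive depths have opposite parity, so exactly one of the two latencies contains a full
loop. -/
theorem latency_add_latency (m i : ℕ) :
    loopCost m m + latency m i + latency m (i + 1) = maxDelay m := by
  unfold maxDelay latency
  rcases Nat.mod_two_eq_zero_or_one i with h | h
  · have : (i + 1) % 2 = 1 := by lia
    simp [h, this]
  · have : (i + 1) % 2 = 0 := by lia
    simp [h, this]
    lia

theorem loopCost_mono {m k l : ℕ} (h : k ≤ l) : loopCost m k ≤ loopCost m l :=
  Nat.add_le_add_right (Nat.mul_le_mul_right _ h) _

theorem loopCost_succ (m k : ℕ) : loopCost m (k + 1) = loopCost m k + iterCost m := by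
  unfold loopCost
  ring

/-- What is required of two consecutive outputs. -/
def Near {n : ℕ} (m : ℕ) (e f : Arcs n × ℕ) : Prop :=
  shd (ofArcs e.1) (ofArcs f.1) ≤ 3 ∧ f.2 ≤ e.2 + maxDelay m

/-- The part of a run between the states `s` and `s'`, with outputs `l`. -/
structure Segment {n : ℕ} (G : Digraph (Fin n)) (L : Arcs n) (s s' : State n)
    (l : List (Arcs n × ℕ)) : Prop where
  log_eq : s'.log = s.log ++ l
  seen_subset : seen G L s.vis ⊆ seen G L s'.vis
  nodup : (l.map Prod.fst).Nodup
  chain : l.IsChain (Near L.length)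
  closed : ∀ E ∈ l.map Prod.fst, ∀ x y, Covered (ofArcs E) x y →
    flip x y E ∈ seen G L s'.vis

theorem Segment.append {n : ℕ} {G : Digraph (Fin n)} {L : Arcs n} {s s₁ s₂ : State n}
    {l₁ l₂ : List (Arcs n × ℕ)} (h₁ : Segment G L s s₁ l₁) (h₂ : Segment G L s₁ s₂ l₂)
    (hd : (l₁.map Prod.fst).Disjoint (l₂.map Prod.fst))
    (hj : ∀ e ∈ l₁.getLast?, ∀ f ∈ l₂.head?, Near L.length e f) :
    Segment G L s s₂ (l₁ ++ l₂) where
  log_eq := by rw [h₂.log_eq, h₁.log_eq, List.append_assoc]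
  seen_subset := h₁.seen_subset.trans h₂.seen_subset
  nodup := by
    rw [List.map_append]
    exact h₁.nodup.append h₂.nodup hd
  chain := List.isChain_append.2 ⟨h₁.chain, h₂.chain, hj⟩
  closed := by
    intro E hE x y hxy
    rw [List.map_append, List.mem_append] at hE
    rcases hE with hE | hE
    · exact h₂.seen_subset (h₁.closed E hE x y hxy)
    · exact h₂.closed E hE x y hxy

/-- What a call of `enumerate` does. -/
structure EnumSpec {n : ℕ} (G : Digraph (Fin n)) (L D : Arcs n) (i : ℕ) (s s' : State n)
    (l : List (Arcs n × ℕ)) : Prop extends Segment G L s s' l where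
  mem_iff : ∀ E, E ∈ l.map Prod.fst ↔ E = D ∨ (E ∈ seen G L s'.vis ∧ E ∉ seen G L s.vis)
  -- At even depth the first output is `D`; at odd depth it is `D` or its first child. The bound for
  -- `last` is the mirror image.
  head : ∀ e ∈ l.head?, shd (ofArcs D) (ofArcs e.1) ≤ i % 2 ∧ e.2 ≤ s.clock + latency L.length i
  last : ∀ e ∈ l.getLast?, shd (ofArcs e.1) (ofArcs D) ≤ (i + 1) % 2 ∧
    s'.clock ≤ e.2 + latency L.length (i + 1)

/-- What the remaining part of the loop does. -/
structure LoopSpec {n : ℕ} (G : Digraph (Fin n)) (L D todo : Arcs n) (i : ℕ) (s s' : State n)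
    (l : List (Arcs n × ℕ)) : Prop extends Segment G L s s' l where
  mem_iff : ∀ E, E ∈ l.map Prod.fst ↔ E ∈ seen G L s'.vis ∧ E ∉ seen G L s.vis
  tried : ∀ x y, (x, y) ∈ todo → Covered (ofArcs D) x y → flip x y D ∈ seen G L s'.vis
  head : ∀ e ∈ l.head?, shd (ofArcs D) (ofArcs e.1) ≤ 1 + (i + 1) % 2 ∧
    e.2 ≤ s.clock + loopCost L.length todo.length + latency L.length (i + 1)
  last : ∀ e ∈ l.getLast?, shd (ofArcs e.1) (ofArcs D) ≤ 1 + i % 2 ∧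
    s'.clock ≤ e.2 + loopCost L.length todo.length + latency L.length i
  clock_le : l = [] → s'.clock ≤ s.clock + loopCost L.length todo.length

theorem forEach_nil_run {n : ℕ} (D : Arcs n) (i : ℕ) (s : State n) :
    forEach D [] i s = some ((), { s with clock := s.clock + 1 }) := by
  rw [forEach]
  rfl

/-- One iteration of the loop, up to the recursive call. -/
theorem forEach_cons_run {n : ℕ} {D : Arcs n} (hD : Sorted D) {x y : Fin n} (hxy : (x, y) ∈ D)
    (todo : Arcs n) (i : ℕ) (s : State n) :
    ∃ s₁ : State n, s₁.log = s.log ∧ s₁.clock ≤ s.clock + iterCost D.length ∧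
      ((forEach D ((x, y) :: todo) i s = forEach D todo i s₁ ∧ s₁.vis = s.vis ∧
          (Covered (ofArcs D) x y → s.vis.Mem (key (flip x y D)))) ∨
        (forEach D ((x, y) :: todo) i s =
            (enumerate (flip x y D) (i + 1) >>= fun _ => forEach D todo i) s₁ ∧
          Covered (ofArcs D) x y ∧ ¬ s.vis.Mem (key (flip x y D)) ∧
          ∀ l : List Bool, l.length = (flip x y D).length →
            (s₁.vis.Mem l ↔ l = key (flip x y D) ∨ s.vis.Mem l))) := by
  have hlen : (flip x y D).length = D.length := by simp [flip]
  obtain ⟨b, h₁, hb⟩ := computes_isCovered hD x y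
  have hb' : b = true ↔ Covered (ofArcs D) x y := hb.trans (iff_and_self.2 fun _ => hxy)
  rw [forEach, bind_run (s' := { s with clock := s.clock + 1 }) rfl]
  obtain ⟨k₁, hk₁, h₁⟩ := h₁ { s with clock := s.clock + 1 }
  cases b with
  | false =>
    refine ⟨_, ?_, ?_, Or.inl ⟨bind_run h₁, ?_, ?_⟩⟩
    · rfl
    · simp only [iterCost]
      lia
    · rfl
    · exact fun h => absurd (hb'.2 h) (by simp)
  | true =>
    obtain ⟨k₂, hk₂, h₂⟩ := computes_reverseArc x y D { s with clock := s.clock + 1 + k₁ }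
    obtain ⟨c, k₃, hk₃, h₃, hc⟩ := isVisited_run (flip x y D)
      { s with clock := s.clock + 1 + k₁ + k₂ }
    cases c with
    | true =>
      refine ⟨_, ?_, ?_, Or.inl ⟨(bind_run h₁).trans ((bind_run h₂).trans (bind_run h₃)), ?_, ?_⟩⟩
      · rfl
      · simp only [iterCost]
        lia
      · rfl
      · exact fun _ => hc.1 rfl
    | false =>
      obtain ⟨t, k₄, hk₄, h₄, ht⟩ := markVisited_run (flip x y D)
        { s with clock := s.clock + 1 + k₁ + k₂ + k₃ }
      refine ⟨_, ?_, ?_, Or.inr ⟨(bind_run h₁).trans ((bind_run h₂).trans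
        ((bind_run h₃).trans (bind_run h₄))), hb'.1 rfl, ?_, ht⟩⟩
      · rfl
      -- The total is at most `1 + (4m + 6) + (m + 1) + (m + 2) + (m + 2)`.
      · simp only [iterCost]
        lia
      · exact fun h => absurd (hc.2 h) (by simp)

theorem segment_refl {n : ℕ} (G : Digraph (Fin n)) (L : Arcs n) {s s' : State n}
    (hl : s'.log = s.log) (hv : s'.vis = s.vis) : Segment G L s s' [] where
  log_eq := by simp [hl]
  seen_subset := by rw [hv]
  nodup := by simp
  chain := by simp
  closed := by simp

theorem enumerate_even_run {n : ℕ} (D : Arcs n) {i : ℕ} (hi : i % 2 = 0) (s : State n) :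
    enumerate D i s = (output D >>= fun _ => forEach D D i) { s with clock := s.clock + 1 } := by
  rw [enumerate, bind_run (s' := { s with clock := s.clock + 1 }) rfl]
  simp [hi]

theorem enumerate_odd_run {n : ℕ} (D : Arcs n) {i : ℕ} (hi : i % 2 = 1) (s : State n) :
    enumerate D i s = (forEach D D i >>= fun _ => output D) { s with clock := s.clock + 1 } := by
  rw [enumerate, bind_run (s' := { s with clock := s.clock + 1 }) rfl]
  simp [hi]

theorem latency_of_even {m i : ℕ} (h : i % 2 = 0) : latency m i = m + 5 := by
  simp [latency, h]

theorem latency_of_odd {m i : ℕ} (h : i % 2 = 1) : latency m i = loopCost m m + m + 6 := by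
  simp [latency, h]

/-- `enumerate` behaves as specified if its loop does. -/
theorem enumerate_spec_of_forEach {n : ℕ} {G : Digraph (Fin n)} {L D : Arcs n}
    (hD : D ∈ members G L) (i : ℕ) (s : State n) (hs : D ∈ seen G L s.vis)
    (h : ∀ s₁ : State n, s₁.vis = s.vis →
      ∃ s' l, forEach D D i s₁ = some ((), s') ∧ LoopSpec G L D D i s₁ s' l) :
    ∃ s' l, enumerate D i s = some ((), s') ∧ EnumSpec G L D i s s' l := by
  have hlen := length_eq_of_shape_eq hD.1
  have hmax := latency_add_latency L.length i
  rcases Nat.mod_two_eq_zero_or_one i with hi | hi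
  · have hi' : (i + 1) % 2 = 1 := by lia
    rw [latency_of_even hi, latency_of_odd hi'] at hmax
    obtain ⟨k, hk, h₁⟩ := output_run D { s with clock := s.clock + 1 }
    obtain ⟨s', l, h₂, hl⟩ :=
      h ⟨s.vis, s.clock + 1 + k, s.log ++ [(D, s.clock + 1 + k)]⟩ rfl
    have hhead := hl.head
    have hlast := hl.last
    have hclock := hl.clock_le
    simp only [hlen, latency_of_even hi, latency_of_odd hi', hi, hi'] at hhead hlast hclock hk
    refine ⟨s', (D, s.clock + 1 + k) :: l, ?_, ⟨?_, hl.seen_subset, ?_, ?_, ?_⟩, ?_, ?_, ?_⟩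
    · rw [enumerate_even_run D hi, bind_run h₁, h₂]
    · rw [hl.log_eq, List.append_assoc]
      rfl
    · rw [List.map_cons, List.nodup_cons, hl.mem_iff]
      exact ⟨fun h => h.2 hs, hl.nodup⟩
    · refine List.isChain_cons.2 ⟨fun e he => ?_, hl.chain⟩
      obtain ⟨h₃, h₄⟩ := hhead e he
      refine ⟨h₃.trans (by lia), ?_⟩
      dsimp only at h₄ ⊢
      lia
    · intro E hE x y hxy
      rcases List.mem_cons.1 hE with rfl | hE
      · exact hl.tried x y hxy.1 hxy
      · exact hl.closed E hE x y hxy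
    · intro E
      rw [List.map_cons, List.mem_cons, hl.mem_iff]
    · intro e he
      obtain rfl : (D, s.clock + 1 + k) = e := by simpa using he
      refine ⟨by simp [shd_self], ?_⟩
      rw [latency_of_even hi]
      dsimp only
      lia
    · intro e he
      rw [latency_of_odd hi', hi']
      rcases l.eq_nil_or_concat with rfl | ⟨l', e', rfl⟩
      · obtain rfl : (D, s.clock + 1 + k) = e := by simpa using he
        have := hclock rfl
        refine ⟨by simp [shd_self], ?_⟩
        dsimp only at this ⊢
        lia
      · obtain ⟨h₃, h₄⟩ := hlast e (by simpa [List.getLast?_cons] using he)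
        exact ⟨h₃.trans (by lia), by lia⟩
  · have hi' : (i + 1) % 2 = 0 := by lia
    rw [latency_of_odd hi, latency_of_even hi'] at hmax
    obtain ⟨s', l, h₂, hl⟩ := h { s with clock := s.clock + 1 } rfl
    obtain ⟨k, hk, h₁⟩ := output_run D s'
    have hhead := hl.head
    have hlast := hl.last
    have hclock := hl.clock_le
    simp only [hlen, latency_of_even hi', latency_of_odd hi, hi, hi'] at hhead hlast hclock hk
    refine ⟨⟨s'.vis, s'.clock + k, s'.log ++ [(D, s'.clock + k)]⟩,
      l ++ [(D, s'.clock + k)], ?_, ⟨?_, hl.seen_subset, ?_, ?_, ?_⟩, ?_, ?_, ?_⟩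
    · rw [enumerate_odd_run D hi, bind_run h₂, h₁]
    · dsimp only
      rw [hl.log_eq, List.append_assoc]
    · rw [List.map_append]
      refine hl.nodup.append (List.nodup_singleton _) ?_
      intro E hE hE'
      obtain rfl : E = D := by simpa using hE'
      exact ((hl.mem_iff E).1 hE).2 hs
    · refine List.isChain_append.2 ⟨hl.chain, .singleton _, fun e he f hf => ?_⟩
      obtain rfl : (D, s'.clock + k) = f := by simpa using hf
      obtain ⟨h₃, h₄⟩ := hlast e he
      refine ⟨h₃.trans (by lia), ?_⟩
      dsimp only
      lia
    · intro E hE x y hxy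
      rw [List.map_append, List.mem_append] at hE
      rcases hE with hE | hE
      · exact hl.closed E hE x y hxy
      · obtain rfl : E = D := by simpa using hE
        exact hl.tried x y hxy.1 hxy
    · intro E
      rw [List.map_append, List.mem_append, hl.mem_iff, or_comm]
      simp
    · intro e he
      rw [latency_of_odd hi, hi]
      cases l with
      | nil =>
        obtain rfl : (D, s'.clock + k) = e := by simpa using he
        have := hclock rfl
        refine ⟨by simp [shd_self], ?_⟩
        dsimp only at this ⊢
        lia
      | cons e' l =>
        obtain ⟨h₃, h₄⟩ := hhead e (by simpa using he)
        exact ⟨h₃.trans (by lia), by lia⟩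
    · intro e he
      obtain rfl : (D, s'.clock + k) = e := by simpa using he
      exact ⟨by simp [shd_self], Nat.le_add_right _ _⟩

/-- The number of members that are not yet visited. -/
noncomputable def unseen {n : ℕ} (G : Digraph (Fin n)) (L : Arcs n) (t : Trie) : ℕ :=
  (members G L \ seen G L t).ncard

theorem unseen_le_unseen {n : ℕ} {G : Digraph (Fin n)} {L : Arcs n} {t t' : Trie}
    (h : seen G L t ⊆ seen G L t') : unseen G L t' ≤ unseen G L t :=
  Set.ncard_le_ncard (Set.sdiff_subset_sdiff_right h) ((members_finite G L).sdiff)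

theorem unseen_lt_unseen {n : ℕ} {G : Digraph (Fin n)} {L D : Arcs n} {t t' : Trie}
    (hD : D ∈ members G L) (h : D ∉ seen G L t) (h' : seen G L t' = insert D (seen G L t)) :
    unseen G L t' < unseen G L t := by
  refine Set.ncard_lt_ncard ?_ ((members_finite G L).sdiff)
  rw [h']
  refine (Set.ssubset_iff_of_subset (Set.sdiff_subset_sdiff_right (Set.subset_insert _ _))).2
    ⟨D, ⟨hD, h⟩, fun h => h.2 (Set.mem_insert _ _)⟩

/-- Outer induction on the number of unseen members, inner induction on `todo`. A recursive call is
preceded by marking a new member, so both the call and the rest of the loop after it fall under the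
outer hypothesis; a skipped arc only shortens `todo`. -/
theorem forEach_spec {n : ℕ} {G : Digraph (Fin n)} {L D : Arcs n} (hL : Sorted L)
    (hD : D ∈ members G L) {todo : Arcs n} (htodo : todo <:+ D) (i : ℕ) (s : State n) :
    ∃ s' l, forEach D todo i s = some ((), s') ∧ LoopSpec G L D todo i s s' l := by
  induction hk : unseen G L s.vis using Nat.strong_induction_on generalizing D todo i s with
  | _ k ih =>
    induction todo generalizing s k with
    | nil =>
      refine ⟨_, [], forEach_nil_run D i s, segment_refl G L rfl rfl, ?_, ?_, ?_, ?_, ?_⟩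
      · simp
      · simp
      · simp
      · simp
      · simp [loopCost]
    | cons e todo ih' =>
      obtain ⟨x, y⟩ := e
      have hlen := length_eq_of_shape_eq hD.1
      have hxy : (x, y) ∈ D := htodo.subset (List.mem_cons_self)
      have htodo' : todo <:+ D := (List.suffix_cons _ _).trans htodo
      have hsucc := loopCost_succ L.length todo.length
      obtain ⟨s₁, hlog, hclock, h₁⟩ :=
        forEach_cons_run (sorted_of_mem_members hL hD) hxy todo i s
      rw [hlen] at hclock
      rcases h₁ with ⟨hrun, hvis, hmem⟩ | ⟨hrun, hc, hnot, hmark⟩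
      · obtain ⟨s', l, h₂, hl⟩ := ih' k ih htodo' s₁ (by rw [hvis]; exact hk)
        have hsub := hl.seen_subset
        have hmem_iff := hl.mem_iff
        rw [hvis] at hsub hmem_iff
        refine ⟨s', l, hrun.trans h₂, ⟨?_, hsub, hl.nodup, hl.chain, hl.closed⟩, hmem_iff,
          ?_, ?_, ?_, ?_⟩
        · rw [hl.log_eq, hlog]
        · intro a b hab hab'
          rcases List.mem_cons.1 hab with hab | hab
          · obtain ⟨rfl, rfl⟩ := Prod.mk.injEq .. ▸ hab
            exact hsub ⟨flip_mem_members hD hab', hmem hab'⟩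
          · exact hl.tried a b hab hab'
        · intro e he
          obtain ⟨h₃, h₄⟩ := hl.head e he
          refine ⟨h₃, ?_⟩
          rw [List.length_cons]
          lia
        · intro e he
          obtain ⟨h₃, h₄⟩ := hl.last e he
          refine ⟨h₃, ?_⟩
          rw [List.length_cons]
          lia
        · intro h
          have := hl.clock_le h
          rw [List.length_cons]
          lia
      · have hD' := flip_mem_members hD hc
        have hshd := shd_flip_le_one hc
        have hseen := seen_eq_insert hD' hmark
        have hnot' : flip x y D ∉ seen G L s.vis := fun h => hnot h.2
        have hlt := unseen_lt_unseen hD' hnot' hseen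
        have hss₁ : seen G L s.vis ⊆ seen G L s₁.vis := hseen ▸ Set.subset_insert _ _
        obtain ⟨s₂, l₁, h₂, hl₁⟩ := enumerate_spec_of_forEach hD' (i + 1) s₁
          (hseen ▸ Set.mem_insert _ _) fun t ht =>
            ih _ (by rw [← hk]; exact hlt) hD' List.suffix_rfl (i + 1) t (by rw [ht])
        have hle := unseen_le_unseen hl₁.seen_subset
        obtain ⟨s', l₂, h₃, hl₂⟩ := ih _ (by rw [← hk]; exact hle.trans_lt hlt) hD htodo' i s₂ rfl
        have hmem₁ : ∀ E, E ∈ l₁.map Prod.fst ↔ E ∈ seen G L s₂.vis ∧ E ∉ seen G L s.vis := by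
          intro E
          rw [hl₁.mem_iff, hseen, Set.mem_insert_iff]
          have : flip x y D ∈ seen G L s₂.vis := hl₁.seen_subset (hseen ▸ Set.mem_insert _ _)
          constructor
          · rintro (rfl | ⟨h₄, h₅⟩)
            · exact ⟨this, hnot'⟩
            · exact ⟨h₄, fun h => h₅ (Or.inr h)⟩
          · rintro ⟨h₄, h₅⟩
            by_cases h₆ : E = flip x y D
            · exact Or.inl h₆
            · exact Or.inr ⟨h₄, fun h => h.elim h₆ h₅⟩
        -- Every call outputs at least its own argument, so the silent time never accumulates over
        -- several calls.
        have hne : l₁ ≠ [] := by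
          rintro rfl
          simpa using (hl₁.mem_iff (flip x y D)).2 (Or.inl rfl)
        have hseg : Segment G L s s₂ l₁ :=
          ⟨by rw [hl₁.log_eq, hlog], hss₁.trans hl₁.seen_subset, hl₁.nodup, hl₁.chain, hl₁.closed⟩
        have hmono : loopCost L.length todo.length ≤ loopCost L.length L.length :=
          loopCost_mono (hlen ▸ htodo'.length_le)
        have hmax := latency_add_latency L.length i
        have hlat : latency L.length (i + 1 + 1) = latency L.length i := by
          simp [latency, add_assoc]
        have hpar : (i + 1) % 2 + (i + 1 + 1) % 2 = 1 := by lia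
        have hlast₁ : ∀ e ∈ l₁.getLast?, shd (ofArcs e.1) (ofArcs D) ≤ 1 + i % 2 ∧
            s₂.clock ≤ e.2 + latency L.length i := by
          intro e he
          obtain ⟨h₄, h₅⟩ := hl₁.last e he
          have h₆ := shd_triangle (ofArcs e.1) (ofArcs (flip x y D)) (ofArcs D)
          rw [shd_comm (ofArcs (flip x y D)) (ofArcs D)] at h₆
          exact ⟨by lia, hlat ▸ h₅⟩
        refine ⟨s', l₁ ++ l₂, hrun.trans ((bind_run h₂).trans h₃), hseg.append hl₂.toSegment ?_ ?_,
          ?_, ?_, ?_, ?_, ?_⟩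
        · intro E hE hE'
          exact ((hl₂.mem_iff E).1 hE').2 ((hmem₁ E).1 hE).1
        -- Passing through `D`, the distance is at most `(1 + i % 2) + (1 + (i + 1) % 2) = 3`, and
        -- the times add up to `maxDelay`.
        · intro e he f hf
          obtain ⟨h₄, h₅⟩ := hlast₁ e he
          obtain ⟨h₆, h₇⟩ := hl₂.head f hf
          have h₈ := shd_triangle (ofArcs e.1) (ofArcs D) (ofArcs f.1)
          exact ⟨by lia, by lia⟩
        · intro E
          rw [List.map_append, List.mem_append, hmem₁, hl₂.mem_iff]
          have h₄ := @hl₂.seen_subset E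
          have h₅ := @hseg.seen_subset E
          tauto
        · intro a b hab hab'
          rcases List.mem_cons.1 hab with hab | hab
          · obtain ⟨rfl, rfl⟩ := Prod.mk.injEq .. ▸ hab
            exact hl₂.seen_subset (hl₁.seen_subset (hseen ▸ Set.mem_insert _ _))
          · exact hl₂.tried a b hab hab'
        · intro e he
          rw [List.head?_append_of_ne_nil _ hne] at he
          obtain ⟨h₄, h₅⟩ := hl₁.head e he
          have h₆ := shd_triangle (ofArcs D) (ofArcs (flip x y D)) (ofArcs e.1)
          refine ⟨by lia, ?_⟩
          rw [List.length_cons]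
          lia
        · intro e he
          rw [List.length_cons]
          by_cases h₀ : l₂ = []
          · subst h₀
            rw [List.append_nil] at he
            obtain ⟨h₄, h₅⟩ := hlast₁ e he
            have := hl₂.clock_le rfl
            exact ⟨h₄, by lia⟩
          · rw [List.getLast?_append_of_ne_nil _ h₀] at he
            obtain ⟨h₄, h₅⟩ := hl₂.last e he
            exact ⟨h₄, by lia⟩
        · intro h
          exact absurd (List.append_eq_nil_iff.1 h).1 hne

theorem shd3Enum_run {n : ℕ} (L : Arcs n) :
    ∃ t, ∃ k ≤ L.length + 3, shd3Enum L (State.init n) = enumerate L 0 ⟨t, k, []⟩ ∧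
      ∀ l : List Bool, l.length = L.length → (t.Mem l ↔ l = key L) := by
  obtain ⟨t, k, hk, h, ht⟩ := markVisited_run L { State.init n with clock := 1 }
  refine ⟨t, 1 + k, by lia, ?_, fun l hl => ?_⟩
  · rw [shd3Enum, bind_run (s' := { State.init n with clock := 1 }) rfl, bind_run h]
    rfl
  · simpa [State.init, Trie.Mem] using ht l hl

theorem seen_empty {n : ℕ} (G : Digraph (Fin n)) (L : Arcs n) : seen G L .empty = ∅ := by
  simp [seen, Trie.Mem]

/-- A set of members that is closed under reversals of covered arcs represents all of `[G]`. -/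
theorem exists_seen_of_mem_dags {n : ℕ} {G : Digraph (Fin n)} {L : Arcs n} {V : Set (Arcs n)}
    (hL : ofArcs L ∈ dags G) (hLV : L ∈ V)
    (hV : ∀ E ∈ V, ∀ x y, Covered (ofArcs E) x y → flip x y E ∈ V) {D : Digraph (Fin n)}
    (hD : D ∈ dags G) : ∃ E ∈ V, ofArcs E = D := by
  have h := reflTransGen_coveredStep hL hD
  clear hD
  induction h with
  | refl => exact ⟨L, hLV, rfl⟩
  | tail _ h ih =>
    obtain ⟨E, hE, rfl⟩ := ih
    obtain ⟨x, y, hc, rfl⟩ := h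
    exact ⟨flip x y E, hV E hE x y hc, ofArcs_flip hc.1⟩

theorem latency_le (m : ℕ) : latency m 1 ≤ 50 * (m ^ 2 + 1) := by
  have : m ≤ m ^ 2 := by nlinarith [sq_nonneg m, Nat.le_self_pow two_ne_zero m]
  simp only [latency, loopCost, iterCost]
  norm_num
  nlinarith

theorem maxDelay_le {m : ℕ} (hm : 0 < m) : maxDelay m ≤ 100 * m ^ 2 := by
  have h₁ : 1 ≤ m ^ 2 := Nat.one_le_pow _ _ hm
  have h₂ : m ≤ m ^ 2 := Nat.le_self_pow two_ne_zero m
  simp only [maxDelay, latency, loopCost, iterCost]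
  norm_num
  nlinarith

end Shd3

theorem mainTheorem11 :
    ∃ C : ℕ, ∀ (n : ℕ) (G : Digraph (Fin n)), Shd3.IsCPDAG G →
      -- the starting DAG is an arbitrary member of `[G]`
      ∀ L : Shd3.Arcs n, Shd3.Sorted L → Shd3.ofArcs L ∈ Shd3.dags G →
        -- the algorithm terminates
        ∃ s : Shd3.State n, (Shd3.shd3Enum L).run (Shd3.State.init n) = some ((), s) ∧
          -- it outputs every member of `[G]` exactly once, and nothing else
          (s.log.map fun e => Shd3.ofArcs e.1).Nodup ∧
          (∀ D : Digraph (Fin n), D ∈ s.log.map (fun e => Shd3.ofArcs e.1) ↔ D ∈ Shd3.dags G) ∧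
          -- consecutive outputs have structural Hamming distance at most three
          s.log.IsChain (fun e f => Shd3.shd (Shd3.ofArcs e.1) (Shd3.ofArcs f.1) ≤ 3) ∧
          -- delay: the time between two consecutive outputs
          s.log.IsChain (fun e f => f.2 ≤ e.2 + C * Shd3.numEdges G ^ 2) ∧
          -- the time before the first output, and after the last one until termination
          (∀ e ∈ s.log.head?, e.2 ≤ C * (Shd3.numEdges G ^ 2 + 1)) ∧
          (∀ e ∈ s.log.getLast?, s.clock ≤ e.2 + C * (Shd3.numEdges G ^ 2 + 1)) := by
  -- Any constant above 69 would do: `maxDelay m = 14 * m ^ 2 + 42 * m + 13`, which is at most `69 *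
  -- m ^ 2` for `m ≥ 1`.
  refine ⟨100, fun n G _ L hL hG => ?_⟩
  have hLm : L ∈ Shd3.members G L := ⟨rfl, hG⟩
  rw [Shd3.numEdges_eq_length hL hG]
  obtain ⟨t, k, hk, hrun, ht⟩ := Shd3.shd3Enum_run L
  have hseen : Shd3.seen G L t = {L} := by
    rw [Shd3.seen_eq_insert hLm (t := .empty) (by simpa [Shd3.Trie.Mem] using ht),
      Shd3.seen_empty, insert_empty_eq]
  obtain ⟨s, l, hs, hl⟩ := Shd3.enumerate_spec_of_forEach hLm 0 ⟨t, k, []⟩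
    (hseen ▸ Set.mem_singleton L) fun s₁ _ =>
      Shd3.forEach_spec hL hLm List.suffix_rfl 0 s₁
  have hlog : s.log = l := hl.log_eq
  subst hlog
  have hLs : L ∈ Shd3.seen G L s.vis := hl.seen_subset (hseen ▸ Set.mem_singleton L)
  have hmem : ∀ E, E ∈ s.log.map Prod.fst ↔ E ∈ Shd3.seen G L s.vis := by
    intro E
    rw [hl.mem_iff]
    dsimp only
    rw [hseen, Set.mem_singleton_iff]
    constructor
    · rintro (rfl | h)
      · exact hLs
      · exact h.1
    · exact fun h => (em (E = L)).imp_right fun h' => ⟨h, h'⟩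
  have hm := Shd3.latency_le L.length
  have hlen : L.length ≤ L.length ^ 2 := Nat.le_self_pow two_ne_zero _
  have hmap : (s.log.map fun e => Shd3.ofArcs e.1) = (s.log.map Prod.fst).map Shd3.ofArcs := by
    rw [List.map_map]
    rfl
  refine ⟨s, hrun.trans hs, ?_⟩
  rw [hmap]
  refine ⟨?_, fun D => ?_, ?_, ?_, fun e he => ?_, fun e he => ?_⟩
  · refine hl.nodup.map_on fun D hD E hE h => ?_
    exact Shd3.eq_of_ofArcs_eq (Shd3.sorted_of_mem_members hL ((hmem D).1 hD).1)
      (Shd3.sorted_of_mem_members hL ((hmem E).1 hE).1) h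
  · rw [List.mem_map]
    constructor
    · rintro ⟨E, hE, rfl⟩
      exact ((hmem E).1 hE).1.2
    · intro hD
      obtain ⟨E, hE, h⟩ := Shd3.exists_seen_of_mem_dags hG hLs
        (fun E hE => hl.closed E ((hmem E).2 hE)) hD
      exact ⟨E, (hmem E).2 hE, h⟩
  · exact hl.chain.imp fun _ _ h => h.1
  -- Without edges the claimed delay is 0, so there must be no second output; indeed the empty list
  -- is the only member.
  · rcases Nat.eq_zero_or_pos L.length with h₀ | h₀
    · have hnil : ∀ e ∈ s.log, e.1 = [] := fun e he => List.length_eq_zero_iff.1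
        ((Shd3.length_eq_of_shape_eq ((hmem e.1).1 (List.mem_map_of_mem he)).1.1).trans h₀)
      have hnodup := hl.nodup
      rcases hlog : s.log with - | ⟨e, - | ⟨f, l⟩⟩
      · simp
      · simp
      · rw [hlog] at hnodup hnil
        simp [hnil e, hnil f] at hnodup
    · exact hl.chain.imp fun _ _ h => h.2.trans (Nat.add_le_add_left (Shd3.maxDelay_le h₀) _)
  · have h₁ := (hl.head e he).2
    rw [Shd3.latency_of_even rfl] at h₁
    dsimp only at h₁
    lia
  · have h₁ := (hl.last e he).2
    rw [zero_add] at h₁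
    lia
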